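/- Let $0\le t<1$ and $V(z)=|z|^2-t\,\mathrm{Re}(z^2)$. For a real number $N>0$ and a positive integer $n$, let $\rho_n$ be the averaged density $$\rho_n(z)=\mathbb E\Big(\frac1N\sum_{j=1}^n\delta(z-z_j)\Big)$$ (with respect to area measure $\mathrm dA$) of $n$ particles in $\mathbb C$ distributed according to the Gibbs measure $$\frac1{\mathcal Z_n}\Big(\prod_{l<k}|z_l-z_k|^2\Big)e^{-N\sum_{j=1}^nV(z_j)}\prod_{j=1}^n \mathrm dA(z_j),$$ where $\mathcal Z_n$ is the normalization constant; that is, $\rho_n(z)$ is $\frac1N$ times the sum over $j$ of the marginal densities of $z_j$, each obtained by integrating out the other $n-1$ variables. For $T>0$ let $$K=\Big\{z\in\mathbb C:\ \tfrac{1-t}{1+t}(\mathrm{Re}\,z)^2+\tfrac{1+t}{1-t}(\mathrm{Im}\,z)^2\le T\Big\},\qquad U_{\tau,N}=\{z\in\mathbb C:\ \mathrm{dist}(z,\partial K)<N^{-1/2+\tau}\}.$$ Theorem. Let $0\le t<1$, $0<\tau\le 1/2$ and $T>0$. There exist constants $C_0>0$ and $N_0>0$ (depending only on $t,\tau,T$)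 such that for all real $N>N_0$ for which $n=NT$ is an integer, $$\Big|\rho_n(z)-\frac1\pi\Big|<C_0N^{5/6}e^{-N^{2\tau}}\qquad\text{for all } z\in\mathrm{Int}(K)\setminus U_{\tau,N},$$ and, if moreover $\tau<1/2$, $$|\rho_n(z)|<C_0N^{5/6}e^{-N^{2\tau}}\qquad\text{for all } z\in(\mathbb C\setminus K)\setminus U_{\tau,N}.$$ -/

import Mathlib

open MeasureTheory

namespace EllipticGinibre

noncomputable section

/-- The quadratic external potential `V(z) = |z|² - t Re(z²)`. -/
def potential (t : ℝ) (z : ℂ) : ℝ :=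
  ‖z‖ ^ 2 - t * (z ^ 2).re

/-- The unnormalized Gibbs weight
`(∏_{l < k} |z_l - z_k|²) exp (-N ∑_j V(z_j))` of a configuration of `n` particles. -/
def gibbsWeight (t N : ℝ) {n : ℕ} (z : Fin n → ℂ) : ℝ :=
  (∏ k : Fin n, ∏ l ∈ Finset.Iio k, ‖z l - z k‖ ^ 2) *
    Real.exp (-N * ∑ j : Fin n, potential t (z j))

/-- The normalization constant: the integral of the Gibbs weight over `ℂⁿ` with respect to the
product of the area measures. For `0 ≤ t < 1` and `N > 0` the weight is a polynomial times a
Gaussian, so this integral converges and is positive. -/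
def partitionFunction (t N : ℝ) (n : ℕ) : ℝ :=
  ∫ z : Fin n → ℂ, gibbsWeight t N z

/-- The probability density of the Gibbs measure with respect to the product of the area
measures. -/
def gibbsDensity (t N : ℝ) {n : ℕ} (z : Fin n → ℂ) : ℝ :=
  gibbsWeight t N z / partitionFunction t N n

/-- The averaged particle density `ρ_n(z) = 𝔼 ((1/N) ∑_j δ(z - z_j))`, the delta function being
taken with respect to the area measure. The expectation of `δ(z - z_j)` is the integral of the
Gibbs density over all particles but the `j`-th, the position of the `j`-th being `z`.
The total mass is `n / N`; without particles the density is zero. -/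
def particleDensity (t N : ℝ) : ℕ → ℂ → ℝ
  | 0, _ => 0
  | m + 1, z =>
      (1 / N) * ∑ j : Fin (m + 1),
        ∫ w : Fin m → ℂ, gibbsDensity t N (Fin.insertNth (α := fun _ => ℂ) j z w)

/-- The droplet: the closed elliptical region
`(1-t)/(1+t) (Re z)² + (1+t)/(1-t) (Im z)² ≤ T`. -/
def droplet (t T : ℝ) : Set ℂ :=
  {z | (1 - t) / (1 + t) * z.re ^ 2 + (1 + t) / (1 - t) * z.im ^ 2 ≤ T}

/-- The neighbourhood `{z | dist(z, ∂K) < N^(-1/2+τ)}` of the boundary of the droplet `K`. -/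
def boundaryNhd (t T τ N : ℝ) : Set ℂ :=
  {z | Metric.infDist z (frontier (droplet t T)) < N ^ (-(1 / 2) + τ)}

end

end EllipticGinibre

/-! The Gibbs weight is a squared Vandermonde determinant times a Gaussian. Written in the
polynomials orthogonal for `exp (-N V)`, rescaled Hermite polynomials, it integrates out to `ρ_n =
√(1-t²)/π · exp (-N V) · ∑_{k<n} c_k`, where the `c_k ≥ 0` are the coefficients of the diagonal
Mehler kernel at `Z = √(N(1-t²)) z` (`particleDensity_eq`).

Mehler's formula (`hasSum_mehlerCoeff`) evaluates `∑ c_k s^k` for `0 ≤ s`, `t s < 1`. At `s = 1` the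
full series contributes exactly `1/π`. Hence inside the droplet the error is a tail `k ≥ n`, and
outside it the density is a head `k < n`. Either is at most `s^(-n) ∑ c_k s^k`, with `s ≥ 1` and `s
≤ 1` respectively: a Chernoff bound of size `exp (-N · rate t T s z) / √(1-t²s²)` up to a constant
(`abs_particleDensity_sub_le`, `particleDensity_le`).

It remains to find `s` for which `rate` is at least `dist(z, ∂K)²`. Put `s = u²`. The rate is
stationary in `s` exactly when `z` lies on the ellipse confocal with `∂K` whose semi-axes are `√T
(1/u ± t u)/√(1-t²)`; `u = 1` gives `∂K`. There, both the rate and the squared distance from `z` to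
the point of `∂K` with the same eccentric angle are averages, with the same weights, of their values
at the axis ends. This reduces everything to the one-variable inequality `axisGap ≤ axisRate`.

The prefactor blows up as `t s → 1`, so `u` is capped inside the droplet and points near the focal
segment are treated separately; far outside, a fixed positive rate is enough. The resulting bound
needs no power of `N`: the factor `N^(5/6)` enters only through `1 ≤ N^(5/6)`. -/

namespace EllipticGinibre
-- One-variable comparison of rate and gap on the axes
/-- The Chernoff exponent. -/
noncomputable def rate (t T s : ℝ) (z : ℂ) : ℝ :=
  T * Real.log s - (s - 1) * ((1 - t) * z.re ^ 2 / (1 + t * s) + (1 + t) * z.im ^ 2 / (1 - t * s))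

/-- The Chernoff exponent (for `T = 1`) at an end of an axis of the confocal ellipse with
parameter `u`. -/
noncomputable def axisRate (t u : ℝ) : ℝ :=
  2 * Real.log u - (u ^ 2 - 1) * (1 + t * u ^ 2) / (u ^ 2 * (1 + t))

/-- The squared difference (for `T = 1`) of a semi-axis of the droplet and the corresponding
semi-axis of the confocal ellipse with parameter `u`. -/
noncomputable def axisGap (t u : ℝ) : ℝ :=
  (u - 1) ^ 2 * (1 - t * u) ^ 2 / (u ^ 2 * (1 - t ^ 2))

/-- The derivative is kept factored so that its sign can be read off. The last factor is
`(u-1)(1+t)` for `c = 2` and `u - t` for `c = 1`. -/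
theorem hasDerivAt_axisRate_sub {t u : ℝ} (c : ℝ) (h1 : -1 < t) (h2 : t < 1) (hu : 0 < u) :
    HasDerivAt (fun u => axisRate t u - c * axisGap t u)
      (2 * (1 - t * u ^ 2) * (u - 1) / (u ^ 3 * (1 - t ^ 2)) *
        ((u + 1) * (1 - t) - c * (1 - t * u))) u := by
  have hu' : u ≠ 0 := hu.ne'
  have ht : 1 + t ≠ 0 := by linarith
  have ht' : 1 - t ≠ 0 := by linarith
  have ht2 : 1 - t ^ 2 ≠ 0 := by nlinarith
  have hid : HasDerivAt (fun u : ℝ => u) 1 u := hasDerivAt_id u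
  have hsq : HasDerivAt (fun u : ℝ => u ^ 2) (2 * u) u := by simpa using hasDerivAt_pow 2 u
  have hf := ((Real.hasDerivAt_log hu').const_mul 2).sub
    ((((hsq.sub_const 1).mul ((hsq.const_mul t).const_add 1))).div (hsq.mul_const (1 + t))
      (by positivity))
  have hg := ((((hid.sub_const 1).fun_pow 2).mul (((hid.const_mul t).const_sub 1).fun_pow 2)).div
    (hsq.mul_const (1 - t ^ 2)) (mul_ne_zero (by positivity) ht2)).const_mul c
  have h := hf.sub hg
  have hfac : 1 - t ^ 2 = (1 - t) * (1 + t) := by ring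
  convert! h using 1
  simp only [Pi.mul_apply]
  rw [hfac]
  field_simp
  push_cast
  ring

/-- Both sides vanish at `u = 1` and their difference increases on `[1, u]`. The factor 2 is spent
near the focal segment. -/
theorem two_mul_axisGap_le {t u : ℝ} (h1 : -1 < t) (h2 : t < 1) (hu : 1 ≤ u)
    (htu : t * u ^ 2 ≤ 1) : 2 * axisGap t u ≤ axisRate t u := by
  have hmono : MonotoneOn (fun u => axisRate t u - 2 * axisGap t u) (Set.Icc 1 u) := by
    apply monotoneOn_of_hasDerivWithinAt_nonneg (convex_Icc 1 u)
      (f' := fun u => 2 * (1 - t * u ^ 2) * (u - 1) / (u ^ 3 * (1 - t ^ 2)) *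
        ((u + 1) * (1 - t) - 2 * (1 - t * u)))
    · intro x hx
      exact (hasDerivAt_axisRate_sub 2 h1 h2 (by linarith [hx.1])).continuousAt.continuousWithinAt
    · intro x hx
      rw [interior_Icc] at hx
      exact (hasDerivAt_axisRate_sub 2 h1 h2 (by linarith [hx.1])).hasDerivWithinAt
    · intro x hx
      rw [interior_Icc] at hx
      obtain ⟨hx1, hx2⟩ := hx
      have e1 : 0 ≤ 1 - t * x ^ 2 := by
        rcases le_total t 0 with h | h
        · nlinarith [sq_nonneg x]
        · nlinarith
      have e2 : 0 < 1 - t ^ 2 := by nlinarith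
      have e3 : 0 ≤ (x + 1) * (1 - t) - 2 * (1 - t * x) := by nlinarith
      have e4 : 0 ≤ x - 1 := by linarith
      have e5 : 0 < x := by linarith
      positivity
  have := hmono (Set.left_mem_Icc.2 hu) (Set.right_mem_Icc.2 hu) hu
  simp [axisRate, axisGap] at this ⊢
  linarith

/-- Both sides vanish at `u = 1` and their difference decreases on `[u, 1]`; the condition `t ≤ u`
is what makes the factor `x - t` nonnegative. -/
theorem axisGap_le {t u : ℝ} (h1 : -1 < t) (h2 : t < 1) (h0 : 0 < u) (hu : u ≤ 1)
    (htu : t ≤ u) : axisGap t u ≤ axisRate t u := by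
  have hmono : AntitoneOn (fun u => axisRate t u - 1 * axisGap t u) (Set.Icc u 1) := by
    apply antitoneOn_of_hasDerivWithinAt_nonpos (convex_Icc u 1)
      (f' := fun u => 2 * (1 - t * u ^ 2) * (u - 1) / (u ^ 3 * (1 - t ^ 2)) *
        ((u + 1) * (1 - t) - 1 * (1 - t * u)))
    · intro x hx
      exact (hasDerivAt_axisRate_sub 1 h1 h2 (by linarith [hx.1])).continuousAt.continuousWithinAt
    · intro x hx
      rw [interior_Icc] at hx
      exact (hasDerivAt_axisRate_sub 1 h1 h2 (by linarith [hx.1])).hasDerivWithinAt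
    · intro x hx
      rw [interior_Icc] at hx
      obtain ⟨hx1, hx2⟩ := hx
      have e5 : 0 < x := by linarith
      have e1 : 0 ≤ 1 - t * x ^ 2 := by
        rcases le_total t 0 with h | h
        · nlinarith [sq_nonneg x]
        · nlinarith
      have e2 : 0 < 1 - t ^ 2 := by nlinarith
      have e3 : 0 ≤ (x + 1) * (1 - t) - 1 * (1 - t * x) := by nlinarith
      have e4 : 0 ≤ 1 - x := by linarith
      have : 0 ≤ 2 * (1 - t * x ^ 2) * (1 - x) / (x ^ 3 * (1 - t ^ 2)) *
        ((x + 1) * (1 - t) - 1 * (1 - t * x)) := by positivity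
      have e : 2 * (1 - t * x ^ 2) * (x - 1) / (x ^ 3 * (1 - t ^ 2)) *
        ((x + 1) * (1 - t) - 1 * (1 - t * x)) = -(2 * (1 - t * x ^ 2) * (1 - x) /
          (x ^ 3 * (1 - t ^ 2)) * ((x + 1) * (1 - t) - 1 * (1 - t * x))) := by ring
      rw [e]; linarith
  have := hmono (Set.left_mem_Icc.2 hu) (Set.right_mem_Icc.2 hu) hu
  simp [axisRate, axisGap] at this ⊢
  linarith

theorem axisGap_nonneg {t u : ℝ} (h1 : -1 < t) (h2 : t < 1) : 0 ≤ axisGap t u := by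
  have : 0 < 1 - t ^ 2 := by nlinarith
  unfold axisGap; positivity

/-! ### Confocal ellipses and the boundary of the droplet -/

/-- The squared coordinate `x` relative to the corresponding semi-axis of the confocal ellipse. -/
noncomputable def relSq (t u T x : ℝ) : ℝ :=
  x ^ 2 * u ^ 2 * (1 - t ^ 2) / (T * (1 + t * u ^ 2) ^ 2)

theorem relSq_nonneg {t u T x : ℝ} (h1 : -1 < t) (h2 : t < 1) (hT : 0 < T) :
    0 ≤ relSq t u T x := by
  have : 0 < 1 - t ^ 2 := by nlinarith
  unfold relSq; positivity

theorem relSq_one {t T x : ℝ} (h1 : -1 < t) (hT : 0 < T) :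
    T * relSq t 1 T x = (1 - t) / (1 + t) * x ^ 2 := by
  have : 1 + t ≠ 0 := by linarith
  unfold relSq
  field_simp
  ring

/-- In relative coordinates the rate is affine, and the two axes are exchanged by `t ↦ -t`. -/
theorem rate_eq {t u T : ℝ} (h1 : -1 < t) (h2 : t < 1) (hT : 0 < T) (hu : 0 < u)
    (hp : 0 < 1 + t * u ^ 2) (hm : 0 < 1 - t * u ^ 2) (z : ℂ) :
    rate t T (u ^ 2) z = T * (2 * Real.log u
      - (u ^ 2 - 1) * (1 + t * u ^ 2) / (u ^ 2 * (1 + t)) * relSq t u T z.re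
      - (u ^ 2 - 1) * (1 + -t * u ^ 2) / (u ^ 2 * (1 + -t)) * relSq (-t) u T z.im) := by
  have a1 : 1 + t ≠ 0 := by linarith
  have a2 : 1 - t ≠ 0 := by linarith
  have a3 : 1 + -t ≠ 0 := by linarith
  have a4 : 1 + -t * u ^ 2 ≠ 0 := by linarith
  have a5 := hp.ne'
  have a6 := hm.ne'
  have a7 : 1 - t ^ 2 = (1 - t) * (1 + t) := by ring
  have a8 : 1 - (-t) ^ 2 = (1 - t) * (1 + t) := by ring
  have b3 : 1 + -t = 1 - t := by ring
  have b4 : 1 + -t * u ^ 2 = 1 - t * u ^ 2 := by ring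
  unfold rate relSq
  rw [a7, a8, Real.log_pow, b3, b4]
  field_simp
  push_cast
  ring

/-- The squared distance of `x` to its radial image on the axis of the droplet. -/
theorem sq_sub_eq {t u T x : ℝ} (h1 : -1 < t) (h2 : t < 1) (hT : 0 < T) (hu : 0 < u)
    (hp : 0 < 1 + t * u ^ 2) :
    (x - x * ((1 + t) * u / (1 + t * u ^ 2))) ^ 2 = T * (relSq t u T x * axisGap t u) := by
  have a1 : 1 - t ^ 2 ≠ 0 := by nlinarith
  unfold relSq axisGap
  field_simp
  ring

theorem quadratic_image {t u T x : ℝ} (h1 : -1 < t) (hT : 0 < T)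
    (hp : 0 < 1 + t * u ^ 2) :
    (1 - t) / (1 + t) * (x * ((1 + t) * u / (1 + t * u ^ 2))) ^ 2 = T * relSq t u T x := by
  have a1 : 1 + t ≠ 0 := by linarith
  unfold relSq
  field_simp
  ring

/-- The quadratic form defining the droplet. -/
noncomputable def form (t : ℝ) (z : ℂ) : ℝ :=
  (1 - t) / (1 + t) * z.re ^ 2 + (1 + t) / (1 - t) * z.im ^ 2

theorem continuous_form (t : ℝ) : Continuous (form t) := by
  unfold form
  fun_prop

/-- Dilating by any `r > 1` multiplies the form by `r²`, so such a point is a limit of points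
outside the closed droplet. -/
theorem mem_frontier_droplet {t T : ℝ} (hT : 0 < T) {w : ℂ} (hw : form t w = T) :
    w ∈ frontier (droplet t T) := by
  have hcl : IsClosed (droplet t T) := isClosed_le (continuous_form t) continuous_const
  rw [hcl.frontier_eq]
  refine ⟨hw.le, fun hi => ?_⟩
  have hc : Filter.Tendsto (fun r : ℝ => (r : ℂ) * w) (nhds 1) (nhds w) := by
    have : Continuous (fun r : ℝ => (r : ℂ) * w) := by fun_prop
    simpa using this.tendsto 1
  have hev := hc.eventually (mem_interior_iff_mem_nhds.1 hi)
  have hev' : ∀ᶠ r : ℝ in nhdsWithin 1 (Set.Ioi 1), ((r : ℂ) * w) ∈ droplet t T :=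
    hev.filter_mono nhdsWithin_le_nhds
  obtain ⟨r, hr, hr1⟩ := (hev'.and self_mem_nhdsWithin).exists
  have hr1' : (1 : ℝ) < r := hr1
  have hr' : form t ((r : ℂ) * w) ≤ T := hr
  have e : form t ((r : ℂ) * w) = r ^ 2 * form t w := by
    simp [form]; ring
  rw [e, hw] at hr'
  have : 1 < r ^ 2 := by nlinarith
  nlinarith

theorem norm_sq_sub_eq (z w : ℂ) : ‖z - w‖ ^ 2 = (z.re - w.re) ^ 2 + (z.im - w.im) ^ 2 := by
  rw [← Complex.normSq_eq_norm_sq, Complex.normSq_apply]; simp; ring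

/-- The sum of the relative squared coordinates; it is `1` on the confocal ellipse. -/
noncomputable def relSum (t u T : ℝ) (z : ℂ) : ℝ := relSq t u T z.re + relSq (-t) u T z.im

theorem relSum_one {t T : ℝ} (h1 : -1 < t) (h2 : t < 1) (hT : 0 < T) (z : ℂ) :
    T * relSum t 1 T z = form t z := by
  unfold relSum form
  rw [mul_add, relSq_one h1 hT, relSq_one (by linarith) hT]
  ring

/-- The witness rescales each coordinate by the ratio of the semi-axes, carrying the confocal
ellipse onto the droplet boundary. -/
theorem exists_frontier_of_relSum_eq {t u T : ℝ} (h1 : -1 < t) (h2 : t < 1) (hT : 0 < T)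
    (hu : 0 < u) (hp : 0 < 1 + t * u ^ 2) (hm : 0 < 1 - t * u ^ 2) {z : ℂ}
    (hz : relSum t u T z = 1) :
    ∃ w ∈ frontier (droplet t T), ‖z - w‖ ^ 2 =
      T * (relSq t u T z.re * axisGap t u + relSq (-t) u T z.im * axisGap (-t) u) := by
  have hm' : 0 < 1 + -t * u ^ 2 := by linarith
  refine ⟨⟨z.re * ((1 + t) * u / (1 + t * u ^ 2)), z.im * ((1 + -t) * u / (1 + -t * u ^ 2))⟩,
    mem_frontier_droplet hT ?_, ?_⟩
  · have e1 := quadratic_image (u := u) (x := z.re) h1 hT hp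
    have e2 := quadratic_image (u := u) (x := z.im) (t := -t) (by linarith) hT hm'
    have e3 : (1 + t) / (1 - t) = (1 - -t) / (1 + -t) := by congr 1; ring
    unfold form
    rw [e3]
    dsimp only
    rw [e1, e2, ← mul_add, ← relSum, hz, mul_one]
  · rw [norm_sq_sub_eq]
    dsimp only
    rw [sq_sub_eq h1 h2 hT hu hp, sq_sub_eq (by linarith) (by linarith) hT hu hm']
    ring

theorem continuousOn_relSum {t T a b : ℝ} (hT : 0 < T) (z : ℂ)
    (hp : ∀ u ∈ Set.Icc a b, 0 < 1 + t * u ^ 2) (hm : ∀ u ∈ Set.Icc a b, 0 < 1 - t * u ^ 2) :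
    ContinuousOn (fun u => relSum t u T z) (Set.Icc a b) := by
  unfold relSum relSq
  refine ContinuousOn.add (ContinuousOn.div (by fun_prop) (by fun_prop) ?_)
    (ContinuousOn.div (by fun_prop) (by fun_prop) ?_)
  · intro u hu
    have := hp u hu
    positivity
  · intro u hu
    have : 0 < 1 + -t * u ^ 2 := by linarith [hm u hu]
    positivity


/-- The relative squares sum to 1, so the term `2 log u` can be shared between the axes with these
weights. -/
theorem rate_eq_of_relSum_eq {t u T : ℝ} (h1 : -1 < t) (h2 : t < 1) (hT : 0 < T) (hu : 0 < u)
    (hp : 0 < 1 + t * u ^ 2) (hm : 0 < 1 - t * u ^ 2) {z : ℂ} (hz : relSum t u T z = 1) :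
    rate t T (u ^ 2) z =
      T * (relSq t u T z.re * axisRate t u + relSq (-t) u T z.im * axisRate (-t) u) := by
  rw [rate_eq h1 h2 hT hu hp hm]
  unfold axisRate
  unfold relSum at hz
  linear_combination (-T * (2 * Real.log u)) * hz

/-- Take the square root of `r` with the sign of `y`. -/
theorem exists_sq_sub_le {y r : ℝ} (hr : 0 ≤ r) (h : y ^ 2 ≤ r) :
    ∃ v, v ^ 2 = r ∧ (y - v) ^ 2 ≤ r := by
  have hs := Real.sq_sqrt hr
  have hn := Real.sqrt_nonneg r
  rcases le_total 0 y with hy | hy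
  · refine ⟨√r, hs, ?_⟩
    have : y ≤ √r := Real.le_sqrt_of_sq_le h
    nlinarith
  · refine ⟨-√r, by rw [neg_sq, hs], ?_⟩
    have : -y ≤ √r := Real.le_sqrt_of_sq_le (by rwa [neg_sq])
    nlinarith

/-! ### The Chernoff exponent dominates the squared distance -/

/-- If `z` is on or outside the ellipse of parameter `v`, the intermediate value theorem gives a
confocal ellipse through `z`. Otherwise `z` is close to the focal segment; then `u = v` works with
another boundary point. Condition `hv4` says that the minor semi-axis at `v` is at most a quarter of
the droplet's. -/
theorem exists_rate_ge_of_mem_droplet {t T v : ℝ} (h1 : 0 ≤ t) (h2 : t < 1) (hT : 0 < T)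
    (hv : 1 ≤ v) (hvt : t * v ^ 2 < 1) (hv4 : 1 - t * v ^ 2 ≤ v * (1 - t) / 4) {z : ℂ}
    (hz : z ∈ droplet t T) :
    ∃ u ∈ Set.Icc 1 v, ∃ w ∈ frontier (droplet t T), ‖z - w‖ ^ 2 ≤ rate t T (u ^ 2) z := by
  have hb : ∀ u ∈ Set.Icc 1 v, 0 < 1 - t * u ^ 2 := by
    intro u hu
    have : u ^ 2 ≤ v ^ 2 := by nlinarith [hu.1, hu.2]
    nlinarith
  have hp : ∀ u : ℝ, 0 < 1 + t * u ^ 2 := fun u => by positivity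
  have hz1 : relSum t 1 T z ≤ 1 := by
    have : T * relSum t 1 T z ≤ T := by
      rw [relSum_one (by linarith) h2 hT]; exact hz
    nlinarith
  rcases le_or_gt 1 (relSum t v T z) with hc | hc
  · obtain ⟨u, hu, hu1⟩ := intermediate_value_Icc hv
      (continuousOn_relSum hT z (fun u _ => hp u) hb) ⟨hz1, hc⟩
    have hu0 : 0 < u := by linarith [hu.1]
    obtain ⟨w, hw, hzw⟩ := exists_frontier_of_relSum_eq (by linarith) h2 hT hu0 (hp u) (hb u hu) hu1
    refine ⟨u, hu, w, hw, ?_⟩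
    rw [hzw, rate_eq_of_relSum_eq (by linarith) h2 hT hu0 (hp u) (hb u hu) hu1]
    have g1 := two_mul_axisGap_le (t := t) (by linarith) h2 hu.1 (by linarith [hb u hu])
    have g2 := two_mul_axisGap_le (t := -t) (by linarith) (by linarith) hu.1 (by linarith [hp u])
    have n1 := axisGap_nonneg (t := t) (u := u) (by linarith) h2
    have n2 := axisGap_nonneg (t := -t) (u := u) (by linarith) (by linarith)
    have r1 := relSq_nonneg (t := t) (u := u) (x := z.re) (by linarith) h2 hT
    have r2 := relSq_nonneg (t := -t) (u := u) (x := z.im) (by linarith) (by linarith) hT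
    gcongr <;> linarith
  · have hv0 : 0 < v := by linarith
    have hvm : v ∈ Set.Icc 1 v := ⟨hv, le_rfl⟩
    have hm := hb v hvm
    have g1 := two_mul_axisGap_le (t := t) (by linarith) h2 hv (by linarith)
    have g2 := two_mul_axisGap_le (t := -t) (by linarith) (by linarith) hv (by linarith [hp v])
    have n1 := axisGap_nonneg (t := t) (u := v) (by linarith) h2
    have r1 := relSq_nonneg (t := t) (u := v) (x := z.re) (by linarith) h2 hT
    have r2 := relSq_nonneg (t := -t) (u := v) (x := z.im) (by linarith) (by linarith) hT
    unfold relSum at hc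
    set X := relSq t v T z.re with hX
    set Y := relSq (-t) v T z.im with hY
    have ht1 : 0 < 1 - t := by linarith
    have ht2 : 0 < 1 - t ^ 2 := by nlinarith
    -- By `hv4` the minor semi-axes differ by at least 3/4 of the droplet's, and `2 * (3/4)^2 ≥ 1`.
    have hgap : (1 - t) / (1 + t) ≤ 2 * axisGap (-t) v := by
      have k1 : 3 / 4 * (v * (1 - t)) ≤ (v - 1) * (1 + t * v) := by nlinarith
      have k2 : (3 / 4 * (v * (1 - t))) ^ 2 ≤ ((v - 1) * (1 + t * v)) ^ 2 := by gcongr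
      have e : 2 * axisGap (-t) v = 2 * ((v - 1) * (1 + t * v)) ^ 2 / (v ^ 2 * (1 - t ^ 2)) := by
        unfold axisGap
        have a1 : 1 - (-t) ^ 2 = 1 - t ^ 2 := by ring
        rw [a1]; field_simp; ring
      rw [e, div_le_div_iff₀ (by positivity) (by positivity)]
      have k3 : (1 - t) * (v ^ 2 * (1 - t ^ 2)) = (v * (1 - t)) ^ 2 * (1 + t) := by ring
      rw [k3]
      have k4 : (v * (1 - t)) ^ 2 ≤ 2 * ((v - 1) * (1 + t * v)) ^ 2 := by nlinarith
      gcongr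
    have hy : z.im ^ 2 ≤ T * ((1 - t) / (1 + t) * (1 - X)) := by
      have e : z.im ^ 2 = T * ((1 - t) / (1 + t) * Y) * ((1 - t * v ^ 2) / (v * (1 - t))) ^ 2 := by
        have a1 : 1 - (-t) ^ 2 = (1 - t) * (1 + t) := by ring
        have a2 : 1 + -t * v ^ 2 = 1 - t * v ^ 2 := by ring
        rw [hY]; unfold relSq
        rw [a1, a2]; field_simp
      have k : (1 - t * v ^ 2) / (v * (1 - t)) ≤ 1 := by
        rw [div_le_one (by positivity)]
        have : 0 < v * (1 - t) := by positivity
        linarith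
      have k' : ((1 - t * v ^ 2) / (v * (1 - t))) ^ 2 ≤ 1 := pow_le_one₀ (by positivity) k
      rw [e]
      calc T * ((1 - t) / (1 + t) * Y) * ((1 - t * v ^ 2) / (v * (1 - t))) ^ 2
          ≤ T * ((1 - t) / (1 + t) * Y) * 1 := by gcongr
        _ ≤ T * ((1 - t) / (1 + t) * (1 - X)) := by
          rw [mul_one]; gcongr; linarith
    have hX1 : 0 < 1 - X := by linarith
    -- The boundary point keeps the rescaled real part; its imaginary part `y` is then forced up to
    -- sign by the ellipse equation.
    obtain ⟨y, hy1, hy2⟩ := exists_sq_sub_le (by positivity) hy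
    refine ⟨v, hvm, ⟨z.re * ((1 + t) * v / (1 + t * v ^ 2)), y⟩, mem_frontier_droplet hT ?_, ?_⟩
    · have e1 := quadratic_image (u := v) (x := z.re) (by linarith : -1 < t) hT (hp v)
      unfold form
      dsimp only
      rw [e1, hy1, ← hX]
      field_simp
      ring
    · rw [norm_sq_sub_eq, rate_eq (by linarith) h2 hT hv0 (hp v) hm]
      dsimp only
      rw [sq_sub_eq (by linarith) h2 hT hv0 (hp v), ← hX, ← hY]
      -- Replacing `Y` by the larger `1 - X` lowers the rate to an average of the axis rates with
      -- weights `X` and `1 - X`.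
      have q : (v ^ 2 - 1) * (1 + -t * v ^ 2) / (v ^ 2 * (1 + -t)) * Y ≤
          (v ^ 2 - 1) * (1 + -t * v ^ 2) / (v ^ 2 * (1 + -t)) * (1 - X) := by
        have b1 : 0 ≤ v ^ 2 - 1 := by nlinarith
        have b2 : 0 ≤ 1 + -t * v ^ 2 := by linarith
        have b3 : 0 ≤ 1 + -t := by linarith
        gcongr
        linarith
      have m1 : X * axisGap t v ≤ X * axisRate t v := by gcongr; linarith
      have m2 : (1 - X) * ((1 - t) / (1 + t)) ≤ (1 - X) * axisRate (-t) v := by gcongr; linarith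
      have m3 : X * axisRate t v + (1 - X) * axisRate (-t) v ≤ 2 * Real.log v
          - (v ^ 2 - 1) * (1 + t * v ^ 2) / (v ^ 2 * (1 + t)) * X
          - (v ^ 2 - 1) * (1 + -t * v ^ 2) / (v ^ 2 * (1 + -t)) * Y := by
        unfold axisRate
        nlinarith
      have m4 : T * (X * axisGap t v + (1 - X) * ((1 - t) / (1 + t))) ≤ T * (2 * Real.log v
          - (v ^ 2 - 1) * (1 + t * v ^ 2) / (v ^ 2 * (1 + t)) * X
          - (v ^ 2 - 1) * (1 + -t * v ^ 2) / (v ^ 2 * (1 + -t)) * Y) := by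
        gcongr; linarith
      linarith

/-- Either a confocal ellipse with parameter in `[v, 1]` passes through `z`, or `z` lies beyond the
one of parameter `v`. In the latter case the weights sum to more than 1 and `log v ≤ 0`, so the rate
at `v` is bounded below independently of `z`. -/
theorem exists_rate_ge_of_notMem_droplet {t T v : ℝ} (h1 : 0 ≤ t) (h2 : t < 1) (hT : 0 < T)
    (hv0 : 0 < v) (hv : v ≤ 1) (hvt : t ≤ v) {z : ℂ} (hz : z ∉ droplet t T) :
    ∃ u ∈ Set.Icc v 1, (∃ w ∈ frontier (droplet t T), ‖z - w‖ ^ 2 ≤ rate t T (u ^ 2) z) ∨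
      T * min (axisGap t v) (axisGap (-t) v) ≤ rate t T (u ^ 2) z := by
  have hb : ∀ u ∈ Set.Icc v 1, 0 < 1 - t * u ^ 2 := by
    intro u hu
    have : u ^ 2 ≤ 1 := by nlinarith [hu.1, hu.2]
    nlinarith
  have hp : ∀ u : ℝ, 0 < 1 + t * u ^ 2 := fun u => by positivity
  have hz1 : 1 ≤ relSum t 1 T z := by
    have : T < T * relSum t 1 T z := by
      rw [relSum_one (by linarith) h2 hT]; exact not_le.1 hz
    nlinarith
  rcases le_or_gt (relSum t v T z) 1 with hc | hc
  · obtain ⟨u, hu, hu1⟩ := intermediate_value_Icc hv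
      (continuousOn_relSum hT z (fun u _ => hp u) hb) ⟨hc, hz1⟩
    have hu0 : 0 < u := by linarith [hu.1]
    obtain ⟨w, hw, hzw⟩ := exists_frontier_of_relSum_eq (by linarith) h2 hT hu0 (hp u) (hb u hu) hu1
    refine ⟨u, hu, Or.inl ⟨w, hw, ?_⟩⟩
    rw [hzw, rate_eq_of_relSum_eq (by linarith) h2 hT hu0 (hp u) (hb u hu) hu1]
    have g1 := axisGap_le (t := t) (by linarith) h2 hu0 hu.2 (by linarith [hu.1])
    have g2 := axisGap_le (t := -t) (by linarith) (by linarith) hu0 hu.2 (by linarith)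
    have r1 := relSq_nonneg (t := t) (u := u) (x := z.re) (by linarith) h2 hT
    have r2 := relSq_nonneg (t := -t) (u := u) (x := z.im) (by linarith) (by linarith) hT
    gcongr
  · have hvm : v ∈ Set.Icc v 1 := ⟨le_rfl, hv⟩
    refine ⟨v, hvm, Or.inr ?_⟩
    have g1 := axisGap_le (t := t) (by linarith) h2 hv0 hv hvt
    have g2 := axisGap_le (t := -t) (by linarith) (by linarith) hv0 hv (by linarith)
    have r1 := relSq_nonneg (t := t) (u := v) (x := z.re) (by linarith) h2 hT
    have r2 := relSq_nonneg (t := -t) (u := v) (x := z.im) (by linarith) (by linarith) hT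
    have n1 := axisGap_nonneg (t := t) (u := v) (by linarith) h2
    have n2 := axisGap_nonneg (t := -t) (u := v) (by linarith) (by linarith)
    unfold relSum at hc
    rw [rate_eq (by linarith) h2 hT hv0 (hp v) (hb v hvm)]
    set X := relSq t v T z.re
    set Y := relSq (-t) v T z.im
    have hlog : Real.log v ≤ 0 := Real.log_nonpos hv0.le hv
    have m0 : 0 ≤ (X + Y - 1) * (-(2 * Real.log v)) :=
      mul_nonneg (by linarith) (by linarith)
    have m1 : X * axisRate t v + Y * axisRate (-t) v ≤ 2 * Real.log v
          - (v ^ 2 - 1) * (1 + t * v ^ 2) / (v ^ 2 * (1 + t)) * X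
          - (v ^ 2 - 1) * (1 + -t * v ^ 2) / (v ^ 2 * (1 + -t)) * Y := by
      unfold axisRate
      nlinarith
    have m2 : X * min (axisGap t v) (axisGap (-t) v) ≤ X * axisRate t v := by
      gcongr; exact (min_le_left _ _).trans g1
    have m3 : Y * min (axisGap t v) (axisGap (-t) v) ≤ Y * axisRate (-t) v := by
      gcongr; exact (min_le_right _ _).trans g2
    have n3 : 0 ≤ min (axisGap t v) (axisGap (-t) v) := le_min n1 n2
    have m4 : 0 ≤ (X + Y - 1) * min (axisGap t v) (axisGap (-t) v) :=
      mul_nonneg (by linarith) n3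
    gcongr
    linarith

/-! ### Growth of Hermite polynomials and convergence of the Mehler series -/

/-- Once `|e k| * r + t ≤ r^2`, the recurrence propagates the bound `C * r^k`; the constant `C`
absorbs the finitely many earlier terms. -/
theorem exists_le_geometric_of_recurrence {v e : ℕ → ℝ} {t r : ℝ} (ht : 0 ≤ t) (hr : 0 < r)
    (htr : t < r ^ 2) (hv : ∀ k, 0 ≤ v k)
    (he : Filter.Tendsto e Filter.atTop (nhds 0))
    (hrec : ∀ k, v (k + 2) ≤ e k * v (k + 1) + t * v k) :
    ∃ C, 0 ≤ C ∧ ∀ k, v k ≤ C * r ^ k := by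
  have hlim : Filter.Tendsto (fun k => |e k| * r + t) Filter.atTop (nhds (|0| * r + t)) :=
    (he.abs.mul_const r).add_const t
  have hev : ∀ᶠ k in Filter.atTop, |e k| * r + t ≤ r ^ 2 :=
    (hlim.eventually_lt_const (by simpa using htr)).mono fun _ h => h.le
  obtain ⟨K, hK⟩ := Filter.eventually_atTop.1 hev
  set C := ∑ k ∈ Finset.range (K + 2), v k / r ^ k with hC
  have hC0 : 0 ≤ C := Finset.sum_nonneg fun k _ => div_nonneg (hv k) (by positivity)
  refine ⟨C, hC0, fun k => ?_⟩
  induction k using Nat.strong_induction_on with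
  | _ k ih =>
    rcases lt_or_ge k (K + 2) with hk | hk
    · have : v k / r ^ k ≤ C :=
        Finset.single_le_sum (f := fun k => v k / r ^ k)
          (fun k _ => div_nonneg (hv k) (by positivity)) (Finset.mem_range.2 hk)
      rwa [div_le_iff₀ (by positivity)] at this
    · obtain ⟨j, rfl⟩ : ∃ j, k = j + 2 := ⟨k - 2, by omega⟩
      have h1 := ih (j + 1) (by omega)
      have h2 := ih j (by omega)
      calc v (j + 2) ≤ e j * v (j + 1) + t * v j := hrec j
        _ ≤ |e j| * (C * r ^ (j + 1)) + t * (C * r ^ j) := by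
          gcongr
          · exact hv _
          · exact le_abs_self _
        _ = C * r ^ j * (|e j| * r + t) := by ring
        _ ≤ C * r ^ j * r ^ 2 := by
          gcongr; exact hK j (by omega)
        _ = C * r ^ (j + 2) := by ring

/-- The (probabilists') Hermite polynomials of variance `t` at the point `Z`. -/
noncomputable def hermiteSeq (t : ℝ) (Z : ℂ) : ℕ → ℂ
  | 0 => 1
  | 1 => Z
  | k + 2 => Z * hermiteSeq t Z (k + 1) - t * (k + 1) * hermiteSeq t Z k

theorem hermiteSeq_add_two (t : ℝ) (Z : ℂ) (k : ℕ) : hermiteSeq t Z (k + 2) =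
    Z * hermiteSeq t Z (k + 1) - t * (k + 1) * hermiteSeq t Z k := by
  rw [hermiteSeq]

/-- The coefficients of the diagonal Mehler kernel. -/
noncomputable def mehlerCoeff (t : ℝ) (Z : ℂ) (k : ℕ) : ℝ :=
  ‖hermiteSeq t Z k‖ ^ 2 / k.factorial

theorem mehlerCoeff_nonneg (t : ℝ) (Z : ℂ) (k : ℕ) : 0 ≤ mehlerCoeff t Z k := by
  unfold mehlerCoeff; positivity

/-- Divided by `√k!`, the Hermite recurrence has leading coefficient `‖Z‖/√(k+2) → 0`, so only `t`
limits the growth. Thus the Mehler series converges for `t s < 1`. -/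
theorem exists_mehlerCoeff_le {t q : ℝ} (ht : 0 ≤ t) (htq : t < q) (Z : ℂ) :
    ∃ C, 0 ≤ C ∧ ∀ k, mehlerCoeff t Z k ≤ C * q ^ k := by
  have hq : 0 < q := ht.trans_lt htq
  have he : Filter.Tendsto (fun k : ℕ => ‖Z‖ / √((k : ℝ) + 2)) Filter.atTop (nhds 0) := by
    refine Filter.Tendsto.const_div_atTop (Real.tendsto_sqrt_atTop.comp ?_) _
    exact Filter.tendsto_atTop_add_const_right _ _ tendsto_natCast_atTop_atTop
  obtain ⟨C, hC, h⟩ := exists_le_geometric_of_recurrence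
    (v := fun k => ‖hermiteSeq t Z k‖ / √(k.factorial : ℝ)) ht (Real.sqrt_pos.2 hq)
    (by rwa [Real.sq_sqrt hq.le]) (fun k => by positivity) he (fun k => by
      have f1 : √((k + 1).factorial : ℝ) = √((k : ℝ) + 1) * √(k.factorial : ℝ) := by
        rw [Nat.factorial_succ]; push_cast; rw [Real.sqrt_mul (by positivity)]
      have f2 : √((k + 2).factorial : ℝ) = √((k : ℝ) + 2) * √((k + 1).factorial : ℝ) := by
        rw [Nat.factorial_succ]; push_cast
        rw [Real.sqrt_mul (by positivity)]
        congr 2; ring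
      have p0 : 0 < √(k.factorial : ℝ) := Real.sqrt_pos.2 (by positivity)
      have p1 : 0 < √((k : ℝ) + 1) := Real.sqrt_pos.2 (by positivity)
      have p2 : 0 < √((k : ℝ) + 2) := Real.sqrt_pos.2 (by positivity)
      have l12 : √((k : ℝ) + 1) ≤ √((k : ℝ) + 2) := Real.sqrt_le_sqrt (by linarith)
      have s1 : √((k : ℝ) + 1) ^ 2 = k + 1 := Real.sq_sqrt (by positivity)
      have hn : ‖hermiteSeq t Z (k + 2)‖ ≤
          ‖Z‖ * ‖hermiteSeq t Z (k + 1)‖ + t * (k + 1) * ‖hermiteSeq t Z k‖ := by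
        rw [hermiteSeq_add_two]
        refine (norm_sub_le _ _).trans (le_of_eq ?_)
        rw [norm_mul, norm_mul, norm_mul, Complex.norm_real, Real.norm_of_nonneg ht]
        congr 3
        exact_mod_cast Complex.norm_natCast (k + 1)
      rw [f2, f1]
      calc ‖hermiteSeq t Z (k + 2)‖ / (√((k : ℝ) + 2) * (√((k : ℝ) + 1) * √(k.factorial : ℝ)))
          ≤ (‖Z‖ * ‖hermiteSeq t Z (k + 1)‖ + t * (k + 1) * ‖hermiteSeq t Z k‖) /
            (√((k : ℝ) + 2) * (√((k : ℝ) + 1) * √(k.factorial : ℝ))) := by gcongr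
        _ = ‖Z‖ / √((k : ℝ) + 2) *
              (‖hermiteSeq t Z (k + 1)‖ / (√((k : ℝ) + 1) * √(k.factorial : ℝ))) +
            t * (‖hermiteSeq t Z k‖ / √(k.factorial : ℝ)) * (√((k : ℝ) + 1) / √((k : ℝ) + 2)) := by
          field_simp
          rw [s1]
          ring
        _ ≤ ‖Z‖ / √((k : ℝ) + 2) *
              (‖hermiteSeq t Z (k + 1)‖ / (√((k : ℝ) + 1) * √(k.factorial : ℝ))) +
            t * (‖hermiteSeq t Z k‖ / √(k.factorial : ℝ)) * 1 := by
          gcongr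
          exact (div_le_one p2).2 l12
        _ = _ := by ring)
  refine ⟨C ^ 2, by positivity, fun k => ?_⟩
  have h1 := h k
  have h2 : mehlerCoeff t Z k = (‖hermiteSeq t Z k‖ / √(k.factorial : ℝ)) ^ 2 := by
    unfold mehlerCoeff
    rw [div_pow, Real.sq_sqrt (by positivity)]
  rw [h2]
  calc (‖hermiteSeq t Z k‖ / √(k.factorial : ℝ)) ^ 2 ≤ (C * √q ^ k) ^ 2 := by gcongr
    _ = C ^ 2 * (√q ^ 2) ^ k := by ring
    _ = C ^ 2 * q ^ k := by rw [Real.sq_sqrt hq.le]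

theorem summable_mehlerCoeff {t s : ℝ} (ht : 0 ≤ t) (hs : 0 ≤ s) (hts : t * s < 1) (Z : ℂ) :
    Summable fun k : ℕ => ((k : ℝ) + 1) * mehlerCoeff t Z k * s ^ k := by
  obtain ⟨q, hq1, hq2⟩ : ∃ q, t < q ∧ q * s < 1 := by
    rcases hs.eq_or_lt with rfl | hs
    · exact ⟨t + 1, by linarith, by simp⟩
    · obtain ⟨q, h1, h2⟩ := exists_between ((lt_div_iff₀ hs).2 hts)
      exact ⟨q, h1, (lt_div_iff₀ hs).1 h2⟩
  obtain ⟨C, hC, h⟩ := exists_mehlerCoeff_le ht hq1 Z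
  have hq0 : 0 ≤ q * s := mul_nonneg (ht.trans hq1.le) hs
  have hn : ‖q * s‖ < 1 := by rwa [Real.norm_of_nonneg hq0]
  have hsum : Summable fun k : ℕ => C * ((k : ℝ) ^ 1 * (q * s) ^ k + (q * s) ^ k) :=
    ((summable_pow_mul_geometric_of_norm_lt_one 1 hn).add
      (summable_geometric_of_norm_lt_one hn)).mul_left C
  refine Summable.of_nonneg_of_le (fun k => ?_) (fun k => ?_) hsum
  · have := mehlerCoeff_nonneg t Z k
    positivity
  · calc ((k : ℝ) + 1) * mehlerCoeff t Z k * s ^ k ≤ ((k : ℝ) + 1) * (C * q ^ k) * s ^ k := by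
          gcongr; exact h k
      _ = C * ((k : ℝ) ^ 1 * (q * s) ^ k + (q * s) ^ k) := by rw [mul_pow]; ring

theorem summable_mehlerCoeff' {t s : ℝ} (ht : 0 ≤ t) (hs : 0 ≤ s) (hts : t * s < 1) (Z : ℂ) :
    Summable fun k => mehlerCoeff t Z k * s ^ k := by
  refine Summable.of_nonneg_of_le (fun k => ?_) (fun k => ?_) (summable_mehlerCoeff ht hs hts Z)
  · have := mehlerCoeff_nonneg t Z k
    positivity
  · have := mehlerCoeff_nonneg t Z k
    have h : 0 ≤ mehlerCoeff t Z k * s ^ k := by positivity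
    have hk : (0 : ℝ) ≤ k := by positivity
    nlinarith

theorem mehlerCoeff_succ (t : ℝ) (Z : ℂ) (k : ℕ) :
    ((k : ℝ) + 1) * mehlerCoeff t Z (k + 1) = ‖hermiteSeq t Z (k + 1)‖ ^ 2 / k.factorial := by
  unfold mehlerCoeff
  rw [Nat.factorial_succ]; push_cast
  field_simp

theorem summable_mehlerCoeff_succ {t s : ℝ} (ht : 0 ≤ t) (hs : 0 ≤ s) (hts : t * s < 1) (Z : ℂ) :
    Summable fun k : ℕ => ((k : ℝ) + 1) * mehlerCoeff t Z (k + 1) * s ^ k := by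
  obtain ⟨s', h1, h2⟩ : ∃ s', s < s' ∧ t * s' < 1 := by
    rcases ht.eq_or_lt with rfl | ht
    · exact ⟨s + 1, by linarith, by simp⟩
    · rw [mul_comm] at hts
      obtain ⟨q, h1, h2⟩ := exists_between ((lt_div_iff₀ ht).2 hts)
      exact ⟨q, h1, by rw [mul_comm]; exact (lt_div_iff₀ ht).1 h2⟩
  have hs' : 0 < s' := hs.trans_lt h1
  have := ((summable_nat_add_iff 1).2 (summable_mehlerCoeff ht hs'.le h2 Z)).mul_left (1 / s')
  refine Summable.of_nonneg_of_le (fun k => ?_) (fun k => ?_) this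
  · have := mehlerCoeff_nonneg t Z (k + 1)
    positivity
  · have := mehlerCoeff_nonneg t Z (k + 1)
    have e : 1 / s' * ((((k + 1 : ℕ) : ℝ) + 1) * mehlerCoeff t Z (k + 1) * s' ^ (k + 1)) =
        ((k : ℝ) + 1 + 1) * mehlerCoeff t Z (k + 1) * s' ^ k := by
      push_cast; field_simp; ring
    rw [e]
    gcongr
    linarith

/-! ### Mehler's formula by a differential equation -/

/-- The coefficients of the mixed kernel coupling neighbouring Hermite polynomials. -/
noncomputable def mixedTerm (t : ℝ) (Z : ℂ) (s : ℝ) (k : ℕ) : ℂ :=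
  hermiteSeq t Z k * (starRingEnd ℂ) (hermiteSeq t Z (k + 1)) / k.factorial * s ^ k

theorem summable_mixedTerm {t s : ℝ} (ht : 0 ≤ t) (hs : 0 ≤ s) (hts : t * s < 1) (Z : ℂ) :
    Summable (mixedTerm t Z s) := by
  refine Summable.of_norm_bounded (((summable_mehlerCoeff' ht hs hts Z).add
    (summable_mehlerCoeff_succ ht hs hts Z))) fun k => ?_
  rw [mehlerCoeff_succ]
  unfold mixedTerm mehlerCoeff
  rw [norm_mul, norm_div, norm_mul, RCLike.norm_conj, norm_pow, Complex.norm_real,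
    Real.norm_of_nonneg hs, Complex.norm_natCast, ← add_mul, ← add_div]
  gcongr
  nlinarith [sq_nonneg (‖hermiteSeq t Z k‖ - ‖hermiteSeq t Z (k + 1)‖),
    norm_nonneg (hermiteSeq t Z k), norm_nonneg (hermiteSeq t Z (k + 1))]

theorem hasSum_mixedTerm_shift {t s : ℝ} {Z b : ℂ} (hb : HasSum (mixedTerm t Z s) b) :
    HasSum (fun k => k * hermiteSeq t Z (k - 1) * (starRingEnd ℂ) (hermiteSeq t Z k)
      / k.factorial * (s : ℂ) ^ k) (s * b) := by
  rw [← hasSum_nat_add_iff' 1]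
  simp only [Finset.range_one, Finset.sum_singleton, Nat.cast_zero, zero_mul, zero_div, sub_zero]
  convert! hb.mul_left (s : ℂ) using 2 with k
  unfold mixedTerm
  rw [Nat.factorial_succ, Nat.add_sub_cancel]
  have : (k.factorial : ℂ) ≠ 0 := by exact_mod_cast k.factorial_ne_zero
  have : (k : ℂ) + 1 ≠ 0 := by exact_mod_cast k.succ_ne_zero
  push_cast
  field_simp
  ring

theorem hermiteSeq_succ (t : ℝ) (Z : ℂ) (k : ℕ) : hermiteSeq t Z (k + 1) =
    Z * hermiteSeq t Z k - t * (k * hermiteSeq t Z (k - 1)) := by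
  cases k with
  | zero => simp [hermiteSeq]
  | succ k => rw [hermiteSeq_add_two]; push_cast; simp; ring

open ComplexConjugate in
/-- The linear equation for the diagonal Mehler kernel `F` and its derivative `F'`. -/
theorem mehler_ode {t s F F' : ℝ} (hs : 0 ≤ s) (hts : t * s < 1) (ht : 0 ≤ t)
    {Z : ℂ} (hF : HasSum (fun k => mehlerCoeff t Z k * s ^ k) F)
    (hF' : HasSum (fun k : ℕ => ((k : ℝ) + 1) * mehlerCoeff t Z (k + 1) * s ^ k) F') :
    (1 - t ^ 2 * s ^ 2) ^ 2 * F' =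
      (‖Z‖ ^ 2 * (1 + t ^ 2 * s ^ 2) - 2 * t * s * (Z ^ 2).re
        + t ^ 2 * s * (1 - t ^ 2 * s ^ 2)) * F := by
  obtain ⟨b, hb⟩ := summable_mixedTerm ht hs hts Z
  have hFc : HasSum (fun k => hermiteSeq t Z k * conj (hermiteSeq t Z k) / k.factorial
      * (s : ℂ) ^ k) (F : ℂ) := by
    convert! Complex.hasSum_ofReal.2 hF using 2 with k
    unfold mehlerCoeff
    rw [Complex.mul_conj, Complex.normSq_eq_norm_sq]
    push_cast; rfl
  have hFc' : HasSum (fun k => hermiteSeq t Z (k + 1) * conj (hermiteSeq t Z (k + 1))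
      / k.factorial * (s : ℂ) ^ k) (F' : ℂ) := by
    convert! Complex.hasSum_ofReal.2 hF' using 2 with k
    rw [mehlerCoeff_succ, Complex.mul_conj, Complex.normSq_eq_norm_sq]
    push_cast; rfl
  have hsF' : HasSum (fun k : ℕ => (k : ℂ) * (hermiteSeq t Z k * conj (hermiteSeq t Z k)
      / k.factorial * (s : ℂ) ^ k)) (s * F') := by
    rw [← hasSum_nat_add_iff' 1]
    simp only [Finset.range_one, Finset.sum_singleton, Nat.cast_zero, zero_mul, sub_zero]
    convert! hFc'.mul_left (s : ℂ) using 2 with k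
    rw [Nat.factorial_succ]
    have : (k.factorial : ℂ) ≠ 0 := by exact_mod_cast k.factorial_ne_zero
    have : (k : ℂ) + 1 ≠ 0 := by exact_mod_cast k.succ_ne_zero
    push_cast
    field_simp
    ring
  have hbs : HasSum (fun k => conj (mixedTerm t Z s k)) (conj b) :=
    hb.map (starRingEnd ℂ) Complex.continuous_conj
  -- The Hermite recurrence, inserted in the series, gives linear relations: `e1` and its conjugate
  -- determine the mixed kernel `b` from `F`, and `e3` then closes the equation for `F'`.
  have e1 : conj b = Z * F - t * (s * b) := by
    refine hbs.unique ?_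
    convert! (hFc.mul_left Z).sub ((hasSum_mixedTerm_shift hb).mul_left (t : ℂ)) using 2 with k
    unfold mixedTerm
    rw [map_mul, map_div₀, map_mul, Complex.conj_conj, map_pow, Complex.conj_ofReal, map_natCast,
      hermiteSeq_succ]
    ring
  have e2 : b = conj Z * F - t * (s * conj b) := by
    have := congrArg conj e1
    simpa using this
  have hd : HasSum (fun k => hermiteSeq t Z k * conj (hermiteSeq t Z (k + 2)) / k.factorial
      * (s : ℂ) ^ k) (conj Z * b - t * (s * F' + F)) := by
    convert! (hb.mul_left (conj Z)).sub ((hsF'.add hFc).mul_left (t : ℂ)) using 2 with k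
    unfold mixedTerm
    rw [hermiteSeq_add_two]
    simp only [map_sub, map_mul, map_add, map_one, map_natCast, Complex.conj_ofReal]
    ring
  have hd' : HasSum (fun k => k * hermiteSeq t Z (k - 1) * conj (hermiteSeq t Z (k + 1))
      / k.factorial * (s : ℂ) ^ k) (s * (conj Z * b - t * (s * F' + F))) := by
    rw [← hasSum_nat_add_iff' 1]
    simp only [Finset.range_one, Finset.sum_singleton, Nat.cast_zero, zero_mul, zero_div, sub_zero]
    convert! hd.mul_left (s : ℂ) using 2 with k
    rw [Nat.factorial_succ, Nat.add_sub_cancel]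
    have : (k.factorial : ℂ) ≠ 0 := by exact_mod_cast k.factorial_ne_zero
    have : (k : ℂ) + 1 ≠ 0 := by exact_mod_cast k.succ_ne_zero
    push_cast
    field_simp
    ring
  have e3 : (F' : ℂ) = Z * b - t * (s * (conj Z * b - t * (s * F' + F))) := by
    refine hFc'.unique ?_
    convert! (hb.mul_left Z).sub (hd'.mul_left (t : ℂ)) using 2 with k
    unfold mixedTerm
    nth_rewrite 1 [hermiteSeq_succ]
    ring
  have e4 : (1 - (t : ℂ) ^ 2 * s ^ 2) * b = (conj Z - t * s * Z) * F := by
    rw [e1] at e2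
    linear_combination e2
  have hZ1 : Z * conj Z = ((‖Z‖ ^ 2 : ℝ) : ℂ) := by
    rw [Complex.mul_conj, Complex.normSq_eq_norm_sq]
  have hZ2 : Z ^ 2 + (conj Z) ^ 2 = ((2 * (Z ^ 2).re : ℝ) : ℂ) := by
    rw [← map_pow, Complex.add_conj]
  apply Complex.ofReal_injective
  push_cast at hZ1 hZ2 ⊢
  linear_combination (1 - (t : ℂ) ^ 2 * s ^ 2) * e3 + (Z - t * s * conj Z) * e4
    + (1 + (t : ℂ) ^ 2 * s ^ 2) * F * hZ1 - t * s * F * hZ2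

/-- The diagonal Mehler kernel in closed form. -/
noncomputable def mehlerKernel (t : ℝ) (Z : ℂ) (s : ℝ) : ℝ :=
  Real.exp ((s * ‖Z‖ ^ 2 - t * s ^ 2 * (Z ^ 2).re) / (1 - t ^ 2 * s ^ 2)) / √(1 - t ^ 2 * s ^ 2)

theorem hasDerivAt_tsum_mehlerCoeff {t s S : ℝ} (ht : 0 ≤ t) (hS : 0 ≤ S) (htS : t * S < 1)
    (hs : |s| < S) (Z : ℂ) :
    HasDerivAt (fun s => ∑' k, mehlerCoeff t Z k * s ^ k)
      (∑' k : ℕ, ((k : ℝ) + 1) * mehlerCoeff t Z (k + 1) * s ^ k) s := by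
  have hu0 := (summable_mehlerCoeff_succ ht hS htS Z)
  have hu : Summable fun k : ℕ => (k : ℝ) * mehlerCoeff t Z k * S ^ (k - 1) := by
    rw [← summable_nat_add_iff 1]
    simpa using hu0
  have h := hasDerivAt_tsum_of_isPreconnected (g := fun k s => mehlerCoeff t Z k * s ^ k)
    (g' := fun k s => mehlerCoeff t Z k * (k * s ^ (k - 1))) (t := Set.Ioo (-S) S) (y₀ := 0)
    (y := s) hu isOpen_Ioo isPreconnected_Ioo
    (fun n y _ => (hasDerivAt_pow n y).const_mul _)
    (fun n y hy => by
      have hy' : |y| ≤ S := (abs_lt.2 hy).le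
      have := mehlerCoeff_nonneg t Z n
      rw [norm_mul, norm_mul, norm_pow, Real.norm_of_nonneg this, Real.norm_eq_abs y,
        Real.norm_of_nonneg (by positivity)]
      calc mehlerCoeff t Z n * (n * |y| ^ (n - 1)) ≤ mehlerCoeff t Z n * (n * S ^ (n - 1)) := by
            gcongr
        _ = _ := by ring)
    (by
      have : 0 < S := (abs_nonneg s).trans_lt hs
      simp [this])
    (by simpa using summable_mehlerCoeff' ht le_rfl (by simp) Z) (abs_lt.1 hs)
  convert! h using 1
  have hsum : Summable fun k : ℕ => mehlerCoeff t Z k * (k * s ^ (k - 1)) := by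
    refine Summable.of_norm_bounded hu fun k => ?_
    have := mehlerCoeff_nonneg t Z k
    rw [norm_mul, norm_mul, norm_pow, Real.norm_of_nonneg this, Real.norm_eq_abs s,
      Real.norm_of_nonneg (by positivity)]
    calc mehlerCoeff t Z k * (k * |s| ^ (k - 1)) ≤ mehlerCoeff t Z k * (k * S ^ (k - 1)) := by
          gcongr
      _ = _ := by ring
  rw [hsum.tsum_eq_zero_add]
  simp only [Nat.cast_zero, zero_mul, mul_zero, zero_add]
  refine tsum_congr fun k => ?_
  rw [Nat.add_sub_cancel]
  push_cast
  ring

theorem hasDerivAt_inv_mehlerKernel {t s : ℝ} (h : 0 < 1 - t ^ 2 * s ^ 2) (Z : ℂ) :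
    HasDerivAt (fun s => Real.exp (-((s * ‖Z‖ ^ 2 - t * s ^ 2 * (Z ^ 2).re) / (1 - t ^ 2 * s ^ 2)))
        * √(1 - t ^ 2 * s ^ 2))
      (-(Real.exp (-((s * ‖Z‖ ^ 2 - t * s ^ 2 * (Z ^ 2).re) / (1 - t ^ 2 * s ^ 2)))
        * √(1 - t ^ 2 * s ^ 2)) * (‖Z‖ ^ 2 * (1 + t ^ 2 * s ^ 2) - 2 * t * s * (Z ^ 2).re
        + t ^ 2 * s * (1 - t ^ 2 * s ^ 2)) / (1 - t ^ 2 * s ^ 2) ^ 2) s := by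
  have hsq : HasDerivAt (fun u : ℝ => u ^ 2) (2 * s) s := by simpa using hasDerivAt_pow 2 s
  have hd := (hsq.const_mul (t ^ 2)).const_sub 1
  have hn := ((hasDerivAt_id s).mul_const (‖Z‖ ^ 2)).sub ((hsq.const_mul t).mul_const (Z ^ 2).re)
  have he := (hn.div hd h.ne').neg.exp
  have hr := hd.sqrt h.ne'
  convert! he.mul hr using 1
  have hs := Real.sqrt_pos.2 h
  have hs2 := Real.sq_sqrt h.le
  simp only [Pi.div_apply, Pi.sub_apply, Pi.neg_apply, id]
  set r := √(1 - t ^ 2 * s ^ 2)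
  rw [← hs2]
  field_simp
  linear_combination (‖Z‖ ^ 2 - 2 * s * t * (Z ^ 2).re) * hs2

/-- The series and the closed form solve the same first-order linear equation, so the series times
the reciprocal kernel is constant on `[0, s]`, with value 1 at 0. -/
theorem hasSum_mehlerCoeff {t s : ℝ} (ht : 0 ≤ t) (hs : 0 ≤ s) (hts : t * s < 1) (Z : ℂ) :
    HasSum (fun k => mehlerCoeff t Z k * s ^ k) (mehlerKernel t Z s) := by
  have hpos : ∀ x ∈ Set.Icc 0 s, 0 < 1 - t ^ 2 * x ^ 2 := by
    intro x hx
    have h1 : t * x ≤ t * s := by gcongr; exact hx.2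
    have h2 : 0 ≤ t * x := mul_nonneg ht hx.1
    nlinarith
  obtain ⟨S, hS1, hS2⟩ : ∃ S, s < S ∧ t * S < 1 := by
    rcases ht.eq_or_lt with rfl | ht
    · exact ⟨s + 1, by linarith, by simp⟩
    · rw [mul_comm] at hts
      obtain ⟨q, h1, h2⟩ := exists_between ((lt_div_iff₀ ht).2 hts)
      exact ⟨q, h1, by rw [mul_comm]; exact (lt_div_iff₀ ht).1 h2⟩
  have hd : ∀ x ∈ Set.Icc 0 s, HasDerivAt (fun s => (∑' k, mehlerCoeff t Z k * s ^ k) *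
      (Real.exp (-((s * ‖Z‖ ^ 2 - t * s ^ 2 * (Z ^ 2).re) / (1 - t ^ 2 * s ^ 2)))
        * √(1 - t ^ 2 * s ^ 2))) 0 x := by
    intro x hx
    have hx1 : t * x < 1 := lt_of_le_of_lt (by gcongr; exact hx.2) hts
    have h1 := hasDerivAt_tsum_mehlerCoeff (s := x) ht (by linarith) hS2
      (by rw [abs_of_nonneg hx.1]; linarith [hx.2]) Z
    have h2 := hasDerivAt_inv_mehlerKernel (hpos x hx) Z
    have ho := mehler_ode hx.1 hx1 ht (summable_mehlerCoeff' ht hx.1 hx1 Z).hasSum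
      (summable_mehlerCoeff_succ ht hx.1 hx1 Z).hasSum
    convert! h1.mul h2 using 1
    have hne := (hpos x hx).ne'
    rw [mul_comm ((1 - t ^ 2 * x ^ 2) ^ 2), ← eq_div_iff (pow_ne_zero 2 hne)] at ho
    rw [ho]
    ring
  have hc := constant_of_has_deriv_right_zero
    (fun x hx => (hd x hx).continuousAt.continuousWithinAt)
    (fun x hx => (hd x ⟨hx.1, hx.2.le⟩).hasDerivWithinAt) s ⟨hs, le_rfl⟩
  have h0 : (∑' k, mehlerCoeff t Z k * (0 : ℝ) ^ k) = 1 := by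
    rw [tsum_eq_single 0]
    · simp [mehlerCoeff, hermiteSeq]
    · intro k hk; simp [hk]
  rw [h0] at hc
  have hsum := (summable_mehlerCoeff' ht hs hts Z).hasSum
  convert! hsum using 1
  unfold mehlerKernel
  have hq := Real.sqrt_pos.2 (hpos s ⟨hs, le_rfl⟩)
  rw [div_eq_iff hq.ne', ← mul_one (Real.exp _)]
  have hz : (0 * ‖Z‖ ^ 2 - t * 0 ^ 2 * (Z ^ 2).re) / (1 - t ^ 2 * (0 : ℝ) ^ 2) = 0 := by simp
  have hone : 1 - t ^ 2 * (0 : ℝ) ^ 2 = 1 := by simp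
  rw [hz, hone, Real.sqrt_one, neg_zero, Real.exp_zero, mul_one, mul_one, Real.exp_neg] at hc
  rw [mul_one]
  have he := Real.exp_pos ((s * ‖Z‖ ^ 2 - t * s ^ 2 * (Z ^ 2).re) / (1 - t ^ 2 * s ^ 2))
  rw [mul_left_comm, inv_mul_eq_iff_eq_mul₀ he.ne', mul_one] at hc
  exact hc.symm

/-! ### Weighted inner products and orthogonal polynomials -/

open Polynomial ComplexConjugate

theorem potential_eq (t : ℝ) (z : ℂ) :
    potential t z = (1 - t) * z.re ^ 2 + (1 + t) * z.im ^ 2 := by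
  unfold potential
  rw [← Complex.normSq_eq_norm_sq, Complex.normSq_apply, sq z, Complex.mul_re]
  ring

theorem le_potential {t : ℝ} (ht : 0 ≤ t) (z : ℂ) : (1 - t) * ‖z‖ ^ 2 ≤ potential t z := by
  rw [potential_eq, ← Complex.normSq_eq_norm_sq, Complex.normSq_apply]
  nlinarith [mul_nonneg ht (sq_nonneg z.im)]

theorem continuous_potential (t : ℝ) : Continuous (potential t) := by
  unfold potential
  fun_prop

theorem integrable_exp_neg_mul_norm_sq {b : ℝ} (hb : 0 < b) :
    Integrable fun z : ℂ => Real.exp (-b * ‖z‖ ^ 2) := by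
  have h := GaussianFourier.integrable_cexp_neg_mul_sq_norm_add (V := ℂ) (b := (b : ℂ))
    (by simpa using hb) 0 0
  have h2 := h.norm
  convert! h2 using 2 with z
  rw [Complex.norm_exp]
  congr 1
  simp [← Complex.ofReal_pow]

theorem integrable_norm_pow_mul_exp {b : ℝ} (hb : 0 < b) (k : ℕ) :
    Integrable fun z : ℂ => ‖z‖ ^ k * Real.exp (-b * ‖z‖ ^ 2) := by
  have h := (integrable_exp_neg_mul_norm_sq (half_pos hb)).const_mul
    (k.factorial * Real.exp (1 / (2 * b)))
  refine h.mono' (by fun_prop) (Filter.Eventually.of_forall fun z => ?_)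
  rw [Real.norm_of_nonneg (by positivity)]
  have h1 := Real.pow_div_factorial_le_exp ‖z‖ (norm_nonneg z) k
  rw [div_le_iff₀ (by positivity)] at h1
  have h2 : ‖z‖ ≤ b / 2 * ‖z‖ ^ 2 + 1 / (2 * b) := by
    have : b / 2 * ‖z‖ ^ 2 + 1 / (2 * b) - ‖z‖ = (b * ‖z‖ - 1) ^ 2 / (2 * b) := by
      field_simp; ring
    have h3 : 0 ≤ (b * ‖z‖ - 1) ^ 2 / (2 * b) := by positivity
    linarith
  calc ‖z‖ ^ k * Real.exp (-b * ‖z‖ ^ 2)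
      ≤ Real.exp ‖z‖ * k.factorial * Real.exp (-b * ‖z‖ ^ 2) := by gcongr
    _ = k.factorial * Real.exp (‖z‖ + -b * ‖z‖ ^ 2) := by rw [Real.exp_add]; ring
    _ ≤ k.factorial * Real.exp (1 / (2 * b) + -(b / 2) * ‖z‖ ^ 2) := by
      gcongr ?_ * Real.exp ?_
      linarith
    _ = k.factorial * Real.exp (1 / (2 * b)) * Real.exp (-(b / 2) * ‖z‖ ^ 2) := by
      rw [Real.exp_add]; ring

/-- The integrand of the inner product of two polynomials in the weighted space. -/
noncomputable def pairing (t N : ℝ) (p q : ℂ[X]) (z : ℂ) : ℂ :=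
  p.eval z * conj (q.eval z) * (Real.exp (-N * potential t z) : ℝ)

theorem continuous_pairing (t N : ℝ) (p q : ℂ[X]) : Continuous (pairing t N p q) := by
  have := continuous_potential t
  unfold pairing
  have h1 : Continuous fun z : ℂ => p.eval z := p.continuous
  have h2 : Continuous fun z : ℂ => q.eval z := q.continuous
  have h3 := Complex.continuous_conj.comp h2
  exact (h1.mul h3).mul (Complex.continuous_ofReal.comp (by fun_prop))

theorem pairing_add_left (t N : ℝ) (p q r : ℂ[X]) :
    pairing t N (p + q) r = pairing t N p r + pairing t N q r := by
  ext z; simp [pairing]; ring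

theorem pairing_add_right (t N : ℝ) (p q r : ℂ[X]) :
    pairing t N p (q + r) = pairing t N p q + pairing t N p r := by
  ext z; simp [pairing]; ring

theorem integrable_pairing {t N : ℝ} (ht0 : 0 ≤ t) (ht1 : t < 1) (hN : 0 < N) (p q : ℂ[X]) :
    Integrable (pairing t N p q) := by
  induction p using Polynomial.induction_on' with
  | add p₁ p₂ h₁ h₂ => rw [pairing_add_left]; exact h₁.add h₂
  | monomial m a =>
    induction q using Polynomial.induction_on' with
    | add q₁ q₂ h₁ h₂ => rw [pairing_add_right]; exact h₁.add h₂
    | monomial n b =>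
      have hb : 0 < N * (1 - t) := mul_pos hN (by linarith)
      refine ((integrable_norm_pow_mul_exp hb (m + n)).const_mul (‖a‖ * ‖b‖)).mono'
        (continuous_pairing _ _ _ _).aestronglyMeasurable (Filter.Eventually.of_forall fun z => ?_)
      unfold pairing
      rw [norm_mul, norm_mul, RCLike.norm_conj, Complex.norm_real, Real.norm_of_nonneg
        (Real.exp_pos _).le, eval_monomial, eval_monomial, norm_mul, norm_mul, norm_pow, norm_pow]
      have h := le_potential ht0 z
      calc ‖a‖ * ‖z‖ ^ m * (‖b‖ * ‖z‖ ^ n) * Real.exp (-N * potential t z)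
          ≤ ‖a‖ * ‖z‖ ^ m * (‖b‖ * ‖z‖ ^ n) * Real.exp (-(N * (1 - t)) * ‖z‖ ^ 2) := by
            gcongr ?_ * Real.exp ?_
            nlinarith
        _ = _ := by rw [pow_add]; ring

/-- The inner product of two polynomials in the weighted space. -/
noncomputable def weightedInner (t N : ℝ) (p q : ℂ[X]) : ℂ := ∫ z, pairing t N p q z

theorem hasLineDerivAt_pairing (t N : ℝ) (p q : ℂ[X]) (z v : ℂ) :
    HasLineDerivAt ℝ (pairing t N p q)
      (v * pairing t N (derivative p) q z + conj v * pairing t N p (derivative q) z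
        - N * ((1 - t) * v.re * (pairing t N (X * p) q z + pairing t N p (X * q) z)
          - (1 + t) * v.im * Complex.I *
            (pairing t N (X * p) q z - pairing t N p (X * q) z))) z v := by
  unfold HasLineDerivAt
  have hγ : HasDerivAt (fun r : ℝ => z + r • v) v 0 := by
    simpa using ((hasDerivAt_id (0 : ℝ)).smul_const v).const_add z
  have hz : z + (0 : ℝ) • v = z := by simp
  have hp : HasDerivAt (fun r : ℝ => p.eval (z + r • v)) ((derivative p).eval z * v) 0 := by
    have := p.hasDerivAt (z + (0 : ℝ) • v)
    have h := this.comp (0 : ℝ) hγ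
    rwa [hz] at h
  have hq : HasDerivAt (fun r : ℝ => conj (q.eval (z + r • v)))
      (conj ((derivative q).eval z * v)) 0 := by
    have := q.hasDerivAt (z + (0 : ℝ) • v)
    have h := (this.comp (0 : ℝ) hγ)
    rw [hz] at h
    exact h.star
  have hre : HasDerivAt (fun r : ℝ => (z + r • v).re) v.re 0 := by
    simpa using ((hasDerivAt_id (0 : ℝ)).mul_const v.re).const_add z.re
  have him : HasDerivAt (fun r : ℝ => (z + r • v).im) v.im 0 := by
    simpa using ((hasDerivAt_id (0 : ℝ)).mul_const v.im).const_add z.im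
  have hV : HasDerivAt (fun r : ℝ => potential t (z + r • v))
      (2 * (1 - t) * z.re * v.re + 2 * (1 + t) * z.im * v.im) 0 := by
    simp_rw [potential_eq]
    have h := ((hre.fun_pow 2).const_mul (1 - t)).add ((him.fun_pow 2).const_mul (1 + t))
    rw [hz] at h
    convert! h using 1
    push_cast; ring
  have hE := (hV.const_mul (-N)).exp.ofReal_comp
  have h := (hp.mul hq).mul hE
  convert! h using 1
  rw [Pi.mul_apply, hz]
  unfold pairing
  simp only [eval_mul, eval_X, map_mul]
  have e1 : ((2 * (1 - t) * z.re * v.re + 2 * (1 + t) * z.im * v.im : ℝ) : ℂ) =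
      (1 - t) * v.re * (z + conj z) - (1 + t) * v.im * Complex.I * (z - conj z) := by
    rw [Complex.add_conj, Complex.sub_conj]
    push_cast
    linear_combination 2 * (1 + (t : ℂ)) * v.im * z.im * Complex.I_sq
  rw [Complex.ofReal_mul (Real.exp _), Complex.ofReal_mul (-N), e1]
  push_cast
  ring

theorem integral_eq_zero_of_hasLineDerivAt {f f' : ℂ → ℂ} {v : ℂ} (hf : Integrable f)
    (hf' : Integrable f') (h : ∀ z, HasLineDerivAt ℝ f (f' z) z v) : ∫ z, f' z = 0 := by
  -- Integration by parts against the constant function 1.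
  have := integral_bilinear_hasLineDerivAt_right_eq_neg_left_of_integrable (μ := volume)
    (f := fun _ : ℂ => (1 : ℂ)) (f' := fun _ => 0) (g := f) (g' := f') (v := v)
    (B := ContinuousLinearMap.mul ℝ ℂ) (by simp) (by simpa using hf') (by simpa using hf)
    (fun x _ => hasDerivAt_const (0 : ℝ) (1 : ℂ)) (fun x _ => h x)
  simpa using this

theorem integral_line_pairing {t N : ℝ} (ht0 : 0 ≤ t) (ht1 : t < 1) (hN : 0 < N) (p q : ℂ[X])
    (v : ℂ) :
    v * weightedInner t N (derivative p) q + conj v * weightedInner t N p (derivative q)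
        - N * ((1 - t) * v.re * (weightedInner t N (X * p) q + weightedInner t N p (X * q))
          - (1 + t) * v.im * Complex.I * (weightedInner t N (X * p) q - weightedInner t N p (X * q))) = 0 := by
  have hi := integrable_pairing (t := t) (N := N) ht0 ht1 hN
  have i1 := (hi (derivative p) q).const_mul v
  have i2 := (hi p (derivative q)).const_mul (conj v)
  have i3 := ((hi (X * p) q).add (hi p (X * q))).const_mul ((1 - t) * v.re : ℂ)
  have i4 := ((hi (X * p) q).sub (hi p (X * q))).const_mul ((1 + t) * v.im * Complex.I : ℂ)
  have i5 := (i3.sub i4).const_mul (N : ℂ)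
  have h := integral_eq_zero_of_hasLineDerivAt (hi p q) ((i1.add i2).sub i5)
    (fun z => hasLineDerivAt_pairing t N p q z v)
  simp only [Pi.add_apply, Pi.sub_apply] at h i1 i2 i3 i4 i5
  have i12 : Integrable fun z => v * pairing t N (derivative p) q z +
    conj v * pairing t N p (derivative q) z := i1.add i2
  rw [integral_sub i12 i5, integral_add i1 i2, integral_const_mul, integral_const_mul,
    integral_const_mul, integral_sub i3 i4, integral_const_mul, integral_const_mul,
    integral_add (hi _ _) (hi _ _), integral_sub (hi _ _) (hi _ _)] at h
  exact h

theorem inner_sub_left {t N : ℝ} (ht0 : 0 ≤ t) (ht1 : t < 1) (hN : 0 < N) (p q r : ℂ[X]) (c : ℂ) :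
    weightedInner t N (p - C c * q) r = weightedInner t N p r - c * weightedInner t N q r := by
  have hi := integrable_pairing (t := t) (N := N) ht0 ht1 hN
  unfold weightedInner
  rw [← integral_const_mul, ← integral_sub (hi _ _) ((hi _ _).const_mul _)]
  congr 1; ext z; simp [pairing]; ring

theorem inner_natCast_mul_right (t N : ℝ) (p q : ℂ[X]) (k : ℕ) :
    weightedInner t N p (k * q) = k * weightedInner t N p q := by
  unfold weightedInner
  rw [← integral_const_mul]
  congr 1; ext z; simp [pairing]; ring

theorem conj_inner (t N : ℝ) (p q : ℂ[X]) : conj (weightedInner t N p q) = weightedInner t N q p := by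
  unfold weightedInner
  rw [← integral_conj]
  congr 1; ext z; simp only [pairing, map_mul, Complex.conj_conj, Complex.conj_ofReal]; ring

/-- The coefficient in the creation operator `p ↦ z p - c p'`. -/
noncomputable def creationCoeff (t N : ℝ) : ℝ := t / (N * (1 - t ^ 2))

/-- Integrating by parts along 1 and `I` gives two relations; eliminating the inner product with `X
* q` shows that creation is adjoint to differentiation up to a factor. Orthogonality and the norms
follow by induction. -/
theorem inner_creation {t N : ℝ} (ht0 : 0 ≤ t) (ht1 : t < 1) (hN : 0 < N) (p q : ℂ[X]) :
    weightedInner t N (X * p - C (creationCoeff t N : ℂ) * derivative p) q =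
      weightedInner t N p (derivative q) / (N * (1 - t ^ 2)) := by
  rw [inner_sub_left ht0 ht1 hN]
  have h1 := integral_line_pairing ht0 ht1 hN p q 1
  have h2 := integral_line_pairing ht0 ht1 hN p q Complex.I
  simp only [map_one, one_mul, Complex.one_re, Complex.one_im, Complex.I_re, Complex.I_im,
    Complex.conj_I, Complex.ofReal_zero, Complex.ofReal_one, mul_zero, zero_mul, mul_one,
    sub_zero, zero_sub] at h1 h2
  have h3 : weightedInner t N (derivative p) q - weightedInner t N p (derivative q)
      + N * (1 + t) * (weightedInner t N (X * p) q - weightedInner t N p (X * q)) = 0 := by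
    apply mul_left_cancel₀ Complex.I_ne_zero
    linear_combination h2
  have hN' : (N : ℂ) ≠ 0 := by exact_mod_cast hN.ne'
  have ht' : (1 : ℂ) - (t : ℂ) ^ 2 ≠ 0 := by
    have : (1 : ℝ) - t ^ 2 ≠ 0 := by nlinarith
    exact_mod_cast this
  unfold creationCoeff
  push_cast
  field_simp
  linear_combination (-(1 + (t : ℂ)) * h1 + (1 - (t : ℂ)) * h3) / 2

/-- The monic orthogonal polynomials of the weight `exp (-N V)`. -/
noncomputable def monicHermite (t N : ℝ) : ℕ → ℂ[X]
  | 0 => 1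
  | k + 1 => X * monicHermite t N k - C (creationCoeff t N : ℂ) * derivative (monicHermite t N k)

theorem monicHermite_succ (t N : ℝ) (k : ℕ) : monicHermite t N (k + 1) =
    X * monicHermite t N k - C (creationCoeff t N : ℂ) * derivative (monicHermite t N k) := rfl

theorem derivative_monicHermite_succ (t N : ℝ) (k : ℕ) :
    derivative (monicHermite t N (k + 1)) = ((k + 1 : ℕ) : ℂ[X]) * monicHermite t N k := by
  induction k with
  | zero => simp [monicHermite]
  | succ k ih =>
    rw [monicHermite, derivative_sub, derivative_mul, derivative_C_mul, ih, derivative_X,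
      derivative_mul, derivative_natCast]
    rw [monicHermite]
    push_cast
    ring

theorem monicHermite_monic_natDegree (t N : ℝ) (k : ℕ) :
    (monicHermite t N k).Monic ∧ (monicHermite t N k).natDegree = k := by
  induction k with
  | zero => simp [monicHermite]
  | succ k ih =>
    obtain ⟨hm, hd⟩ := ih
    have hXm : (X * monicHermite t N k).Monic := monic_X.mul hm
    have hXd : (X * monicHermite t N k).natDegree = k + 1 := by
      rw [natDegree_X_mul hm.ne_zero, hd]
    have hlt : (C (creationCoeff t N : ℂ) * derivative (monicHermite t N k)).degree <
        (X * monicHermite t N k).degree := by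
      rw [degree_eq_natDegree hXm.ne_zero, hXd]
      refine (degree_le_natDegree).trans_lt ?_
      have h1 := natDegree_C_mul_le (creationCoeff t N : ℂ) (derivative (monicHermite t N k))
      have h2 := natDegree_derivative_le (monicHermite t N k)
      rw [hd] at h2
      exact_mod_cast (by omega : _ < k + 1)
    rw [monicHermite]
    refine ⟨hXm.sub_of_left hlt, ?_⟩
    rw [natDegree_sub_eq_left_of_natDegree_lt, hXd]
    rw [hXd]
    have h1 := natDegree_C_mul_le (creationCoeff t N : ℂ) (derivative (monicHermite t N k))
    have h2 := natDegree_derivative_le (monicHermite t N k)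
    omega

/-- The squared norms of the monic orthogonal polynomials. -/
noncomputable def normSqHermite (t N : ℝ) (k : ℕ) : ℝ :=
  k.factorial / (N * (1 - t ^ 2)) ^ k * (Real.pi / (N * √(1 - t ^ 2)))

theorem inner_one_one {t N : ℝ} (ht0 : 0 ≤ t) (ht1 : t < 1) (hN : 0 < N) :
    weightedInner t N 1 1 = (Real.pi / (N * √(1 - t ^ 2)) : ℝ) := by
  unfold weightedInner pairing
  simp only [eval_one, map_one, one_mul, integral_complex_ofReal]
  congr 1
  rw [← (Complex.volume_preserving_equiv_real_prod.symm).integral_comp'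
    (g := fun z => Real.exp (-N * potential t z))]
  have e : ∀ x : ℝ × ℝ, Real.exp (-N * potential t (Complex.measurableEquivRealProd.symm x)) =
      Real.exp (-(N * (1 - t)) * x.1 ^ 2) * Real.exp (-(N * (1 + t)) * x.2 ^ 2) := by
    intro x
    rw [potential_eq, ← Real.exp_add]
    congr 1
    simp [Complex.measurableEquivRealProd_symm_apply]
    ring
  simp_rw [e]
  rw [Measure.volume_eq_prod, integral_prod_mul (fun x => Real.exp (-(N * (1 - t)) * x ^ 2))
    (fun x => Real.exp (-(N * (1 + t)) * x ^ 2)), integral_gaussian, integral_gaussian,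
    ← Real.sqrt_mul (by have : 0 < 1 - t := by linarith
                        positivity)]
  have h1 : 0 < 1 - t := by linarith
  have h2 : 0 < 1 - t ^ 2 := by nlinarith
  rw [Real.sqrt_eq_iff_mul_self_eq (by positivity) (by positivity)]
  have hs := Real.mul_self_sqrt h2.le
  have e2 : Real.pi / (N * √(1 - t ^ 2)) * (Real.pi / (N * √(1 - t ^ 2))) =
      Real.pi ^ 2 / (N ^ 2 * (√(1 - t ^ 2) * √(1 - t ^ 2))) := by
    field_simp
  have e3 : 1 - t ^ 2 = (1 - t) * (1 + t) := by ring
  rw [e2, hs, e3]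
  field_simp

theorem inner_monicHermite {t N : ℝ} (ht0 : 0 ≤ t) (ht1 : t < 1) (hN : 0 < N) (j k : ℕ) :
    weightedInner t N (monicHermite t N j) (monicHermite t N k) =
      if j = k then (normSqHermite t N k : ℂ) else 0 := by
  have hstep : ∀ p q : ℂ[X], weightedInner t N (X * p - C (creationCoeff t N : ℂ) * derivative p) q =
      weightedInner t N p (derivative q) / (N * (1 - t ^ 2)) := inner_creation ht0 ht1 hN
  have hzero : ∀ j : ℕ, weightedInner t N (monicHermite t N (j + 1)) (monicHermite t N 0) = 0 := by
    intro j
    rw [monicHermite_succ, hstep]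
    simp [monicHermite, weightedInner, pairing]
  induction j generalizing k with
  | zero =>
    cases k with
    | zero =>
      simp [monicHermite, inner_one_one ht0 ht1 hN, normSqHermite]
    | succ k => rw [← conj_inner, hzero]; simp
  | succ j ih =>
    cases k with
    | zero => rw [hzero]; simp
    | succ k =>
      rw [monicHermite_succ t N j, hstep, derivative_monicHermite_succ, inner_natCast_mul_right, ih]
      have ht' : (1 : ℝ) - t ^ 2 ≠ 0 := by nlinarith
      by_cases h : j = k
      · subst h
        simp only [if_true]
        rw [← Complex.ofReal_natCast, ← Complex.ofReal_one, ← Complex.ofReal_pow,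
          ← Complex.ofReal_sub, ← Complex.ofReal_mul, ← Complex.ofReal_mul, ← Complex.ofReal_div]
        congr 1
        unfold normSqHermite
        rw [Nat.factorial_succ]
        push_cast
        have := hN.ne'
        field_simp
        ring
      · simp [h]

theorem hermiteSeq_eq {t N : ℝ} (ht0 : 0 ≤ t) (ht1 : t < 1) (hN : 0 < N) (z : ℂ) (k : ℕ) :
    hermiteSeq t ((√(N * (1 - t ^ 2)) : ℝ) * z) k =
      ((√(N * (1 - t ^ 2)) : ℝ) : ℂ) ^ k * (monicHermite t N k).eval z := by
  have h2 : 0 < 1 - t ^ 2 := by nlinarith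
  have hs : ((√(N * (1 - t ^ 2)) : ℝ) : ℂ) ^ 2 = N * (1 - t ^ 2) := by
    rw [← Complex.ofReal_pow, Real.sq_sqrt (by positivity)]
    push_cast; rfl
  have hc : (creationCoeff t N : ℂ) * (N * (1 - t ^ 2)) = t := by
    have hN' : (N : ℂ) ≠ 0 := by exact_mod_cast hN.ne'
    have ht' : (1 : ℂ) - (t : ℂ) ^ 2 ≠ 0 := by exact_mod_cast h2.ne'
    unfold creationCoeff
    push_cast
    field_simp
  induction k using Nat.strong_induction_on with
  | _ k ih =>
    match k with
    | 0 => simp [hermiteSeq, monicHermite]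
    | 1 => simp [hermiteSeq, monicHermite]
    | k + 2 =>
      rw [hermiteSeq_add_two, ih (k + 1) (by omega), ih k (by omega), monicHermite_succ t N (k + 1),
        derivative_monicHermite_succ]
      simp only [eval_sub, eval_mul, eval_X, eval_C, eval_natCast]
      push_cast
      linear_combination (-((√(N * (1 - t ^ 2)) : ℝ) : ℂ) ^ k * (k + 1) *
        (monicHermite t N k).eval z) * ((creationCoeff t N : ℂ) * (-hs) - hc)

theorem norm_sq_monicHermite_div {t N : ℝ} (ht0 : 0 ≤ t) (ht1 : t < 1) (hN : 0 < N) (z : ℂ)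
    (k : ℕ) : ‖(monicHermite t N k).eval z‖ ^ 2 / normSqHermite t N k =
      mehlerCoeff t ((√(N * (1 - t ^ 2)) : ℝ) * z) k * (N * √(1 - t ^ 2) / Real.pi) := by
  have h2 : 0 < 1 - t ^ 2 := by nlinarith
  have hs := Real.sq_sqrt (show 0 ≤ N * (1 - t ^ 2) by positivity)
  have hk : √(N * (1 - t ^ 2)) ^ (k * 2) = (N * (1 - t ^ 2)) ^ k := by
    rw [mul_comm k, pow_mul, hs]
  unfold mehlerCoeff normSqHermite
  rw [hermiteSeq_eq ht0 ht1 hN, norm_mul, norm_pow, Complex.norm_real, Real.norm_of_nonneg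
    (Real.sqrt_nonneg _), mul_pow (_ ^ k), ← pow_mul, hk]
  have hq := Real.sqrt_pos.2 h2
  field_simp

/-! ### Integrating out particles -/

open Equiv

theorem prod_norm_sq_sub_eq {n : ℕ} (z : Fin n → ℂ) :
    ∏ k : Fin n, ∏ l ∈ Finset.Iio k, ‖z l - z k‖ ^ 2 = ‖(Matrix.vandermonde z).det‖ ^ 2 := by
  rw [Matrix.det_vandermonde, norm_prod, ← Finset.prod_pow]
  simp_rw [norm_prod, ← Finset.prod_pow]
  rw [Finset.prod_comm' (t' := Finset.univ) (s' := fun l => Finset.Ioi l) (by simp)]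
  refine Finset.prod_congr rfl fun i _ => Finset.prod_congr rfl fun j _ => ?_
  rw [norm_sub_rev]

/-- The Leibniz term of the product of a Vandermonde determinant and its conjugate. -/
noncomputable def leibnizTerm (t N : ℝ) {n : ℕ} (σ ρ : Perm (Fin n)) (z : Fin n → ℂ) : ℂ :=
  (Perm.sign σ : ℤ) * (Perm.sign ρ : ℤ) *
    ∏ i, pairing t N (monicHermite t N (σ i)) (monicHermite t N (ρ i)) (z i)

/-- The Vandermonde determinant is unchanged when powers are replaced by monic polynomials of the
same degrees; the determinant and its conjugate are then expanded by Leibniz. -/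
theorem gibbsWeight_eq_sum (t N : ℝ) {n : ℕ} (z : Fin n → ℂ) :
    (gibbsWeight t N z : ℂ) = ∑ σ : Perm (Fin n), ∑ ρ : Perm (Fin n), leibnizTerm t N σ ρ z := by
  have hdet : (Matrix.vandermonde z).det = ∑ σ : Perm (Fin n),
      ((Perm.sign σ : ℤ) : ℂ) * ∏ i, (monicHermite t N (σ i)).eval (z i) := by
    rw [Matrix.det_eval_matrixOfPolynomials_eq_det_vandermonde z
      (fun k : Fin n => monicHermite t N k) (fun k => (monicHermite_monic_natDegree t N k).2)
      (fun k => (monicHermite_monic_natDegree t N k).1), ← Matrix.det_transpose,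
      Matrix.det_apply']
    rfl
  have hnorm : ((‖(Matrix.vandermonde z).det‖ ^ 2 : ℝ) : ℂ) =
      (Matrix.vandermonde z).det * conj (Matrix.vandermonde z).det := by
    rw [Complex.mul_conj, Complex.normSq_eq_norm_sq]
  unfold gibbsWeight
  rw [prod_norm_sq_sub_eq, Complex.ofReal_mul, hnorm, hdet, map_sum, Finset.sum_mul_sum,
    Finset.sum_mul, Finset.mul_sum, Real.exp_sum, Complex.ofReal_prod]
  refine Finset.sum_congr rfl fun σ _ => ?_
  rw [Finset.sum_mul]
  refine Finset.sum_congr rfl fun ρ _ => ?_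
  unfold leibnizTerm pairing
  rw [Finset.prod_mul_distrib, Finset.prod_mul_distrib, map_mul, map_prod, map_intCast]
  ring

/-- Ensures that only diagonal pairs of permutations survive when all particles but the `j`-th are
integrated out. -/
theorem perm_eq_of_forall_succAbove {m : ℕ} {σ ρ : Perm (Fin (m + 1))} (j : Fin (m + 1))
    (h : ∀ i, σ (j.succAbove i) = ρ (j.succAbove i)) : σ = ρ := by
  have hne : ∀ x, x ≠ j → σ x = ρ x := by
    intro x hx
    obtain ⟨i, rfl⟩ := Fin.exists_succAbove_eq hx
    exact h i
  ext x
  by_cases hx : x = j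
  · subst hx
    by_contra hc
    have hc' : σ x ≠ ρ x := fun e => hc (by rw [e])
    set y := ρ.symm (σ x) with hy
    have hρy : ρ y = σ x := by simp [hy]
    have hyx : y ≠ x := fun e => hc' (by rw [← hρy, e])
    have := hne y hyx
    rw [hρy] at this
    exact hyx (σ.injective this)
  · rw [hne x hx]

theorem sign_mul_sign_self {n : ℕ} (σ : Perm (Fin n)) :
    ((Perm.sign σ : ℤ) : ℂ) * (Perm.sign σ : ℤ) = 1 := by
  rw [← Int.cast_mul, ← Units.val_mul, Int.units_mul_self]; simp

theorem integrable_leibnizTerm {t N : ℝ} (ht0 : 0 ≤ t) (ht1 : t < 1) (hN : 0 < N) {n : ℕ}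
    (σ ρ : Perm (Fin n)) : Integrable (leibnizTerm t N σ ρ) :=
  (Integrable.fintype_prod fun i => integrable_pairing ht0 ht1 hN (monicHermite t N (σ i))
    (monicHermite t N (ρ i))).const_mul _

theorem prod_inner_eq {t N : ℝ} (ht0 : 0 ≤ t) (ht1 : t < 1) (hN : 0 < N) {ι : Type*} [Fintype ι]
    (f g : ι → ℕ) [Decidable (∀ i, f i = g i)] :
    ∏ i, weightedInner t N (monicHermite t N (f i)) (monicHermite t N (g i)) =
      if ∀ i, f i = g i then ((∏ i, normSqHermite t N (f i) : ℝ) : ℂ) else 0 := by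
  split_ifs with h
  · push_cast
    refine Finset.prod_congr rfl fun i _ => ?_
    rw [inner_monicHermite ht0 ht1 hN, if_pos (h i), h i]
  · push Not at h
    obtain ⟨i, hi⟩ := h
    refine Finset.prod_eq_zero (Finset.mem_univ i) ?_
    rw [inner_monicHermite ht0 ht1 hN, if_neg hi]

theorem partitionFunction_eq {t N : ℝ} (ht0 : 0 ≤ t) (ht1 : t < 1) (hN : 0 < N) (n : ℕ) :
    partitionFunction t N n = n.factorial * ∏ k : Fin n, normSqHermite t N k := by
  apply Complex.ofReal_injective
  unfold partitionFunction
  rw [← integral_complex_ofReal]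
  simp_rw [gibbsWeight_eq_sum]
  rw [integral_finsetSum _ fun σ _ => integrable_finsetSum _ fun ρ _ =>
    integrable_leibnizTerm ht0 ht1 hN σ ρ]
  have hterm : ∀ σ : Perm (Fin n), ∫ z, ∑ ρ, leibnizTerm t N σ ρ z =
      ((∏ k : Fin n, normSqHermite t N k : ℝ) : ℂ) := by
    intro σ
    rw [integral_finsetSum _ fun ρ _ => integrable_leibnizTerm ht0 ht1 hN σ ρ,
      Finset.sum_eq_single σ]
    · unfold leibnizTerm
      rw [integral_const_mul, integral_fintype_prod_volume_eq_prod, sign_mul_sign_self, one_mul]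
      refine (prod_inner_eq ht0 ht1 hN (fun i => ((σ i : Fin n) : ℕ)) _).trans ?_
      rw [if_pos fun _ => rfl, Equiv.prod_comp σ fun k : Fin n => normSqHermite t N k]
    · intro ρ _ hρ
      unfold leibnizTerm
      rw [integral_const_mul, integral_fintype_prod_volume_eq_prod]
      have := prod_inner_eq ht0 ht1 hN (fun i => ((σ i : Fin n) : ℕ)) (fun i => ((ρ i : Fin n) : ℕ))
      rw [if_neg (fun h => hρ (Equiv.ext fun i => (Fin.ext (h i)).symm))] at this
      exact mul_eq_zero_of_right _ this
    · simp
  rw [Finset.sum_congr rfl fun σ _ => hterm σ, Finset.sum_const, Finset.card_univ,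
    Fintype.card_perm, Fintype.card_fin]
  push_cast
  rw [nsmul_eq_mul]

theorem normSqHermite_pos {t N : ℝ} (ht0 : 0 ≤ t) (ht1 : t < 1) (hN : 0 < N) (k : ℕ) :
    0 < normSqHermite t N k := by
  have h2 : 0 < 1 - t ^ 2 := by nlinarith
  have := Real.sqrt_pos.2 h2
  have := Real.pi_pos
  unfold normSqHermite
  positivity

theorem integral_gibbsWeight_insertNth {t N : ℝ} (ht0 : 0 ≤ t) (ht1 : t < 1) (hN : 0 < N) (m : ℕ)
    (j : Fin (m + 1)) (z : ℂ) :
    ∫ w : Fin m → ℂ, gibbsWeight t N (Fin.insertNth (α := fun _ => ℂ) j z w) =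
      ∑ σ : Perm (Fin (m + 1)), ‖(monicHermite t N (σ j)).eval z‖ ^ 2 / normSqHermite t N (σ j) *
        Real.exp (-N * potential t z) * ∏ k : Fin (m + 1), normSqHermite t N k := by
  apply Complex.ofReal_injective
  rw [← integral_complex_ofReal]
  simp_rw [gibbsWeight_eq_sum]
  have hsplit : ∀ (σ ρ : Perm (Fin (m + 1))) (w : Fin m → ℂ),
      leibnizTerm t N σ ρ (Fin.insertNth (α := fun _ => ℂ) j z w) =
        ((Perm.sign σ : ℤ) * (Perm.sign ρ : ℤ) *
          pairing t N (monicHermite t N (σ j)) (monicHermite t N (ρ j)) z) *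
        ∏ i, pairing t N (monicHermite t N (σ (j.succAbove i)))
          (monicHermite t N (ρ (j.succAbove i))) (w i) := by
    intro σ ρ w
    unfold leibnizTerm
    rw [Fin.prod_univ_succAbove _ j]
    simp only [Fin.insertNth_apply_same, Fin.insertNth_apply_succAbove]
    ring
  simp_rw [hsplit]
  have hint : ∀ σ ρ : Perm (Fin (m + 1)), Integrable fun w : Fin m → ℂ =>
      ((Perm.sign σ : ℤ) * (Perm.sign ρ : ℤ) *
          pairing t N (monicHermite t N (σ j)) (monicHermite t N (ρ j)) z) *
        ∏ i, pairing t N (monicHermite t N (σ (j.succAbove i)))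
          (monicHermite t N (ρ (j.succAbove i))) (w i) := fun σ ρ =>
    (Integrable.fintype_prod fun i => integrable_pairing ht0 ht1 hN _ _).const_mul _
  rw [integral_finsetSum _ fun σ _ => integrable_finsetSum _ fun ρ _ => hint σ ρ,
    Complex.ofReal_sum]
  refine Finset.sum_congr rfl fun σ _ => ?_
  rw [integral_finsetSum _ fun ρ _ => hint σ ρ, Finset.sum_eq_single σ]
  · rw [integral_const_mul, integral_fintype_prod_volume_eq_prod, sign_mul_sign_self, one_mul]
    have h := prod_inner_eq ht0 ht1 hN (fun i => ((σ (j.succAbove i) : Fin (m + 1)) : ℕ))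
      (fun i => ((σ (j.succAbove i) : Fin (m + 1)) : ℕ))
    rw [if_pos fun _ => rfl] at h
    refine (congrArg _ h).trans ?_
    rw [← Equiv.prod_comp σ fun k : Fin (m + 1) => normSqHermite t N k,
      Fin.prod_univ_succAbove _ j]
    have hne := (normSqHermite_pos ht0 ht1 hN (σ j)).ne'
    unfold pairing
    rw [Complex.mul_conj, Complex.normSq_eq_norm_sq, ← Complex.ofReal_mul, ← Complex.ofReal_mul]
    congr 1
    field_simp
  · intro ρ _ hρ
    rw [integral_const_mul, integral_fintype_prod_volume_eq_prod]
    have h := prod_inner_eq ht0 ht1 hN (fun i => ((σ (j.succAbove i) : Fin (m + 1)) : ℕ))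
      (fun i => ((ρ (j.succAbove i) : Fin (m + 1)) : ℕ))
    rw [if_neg (fun h => hρ (perm_eq_of_forall_succAbove j fun i => Fin.ext (h i)).symm)] at h
    exact mul_eq_zero_of_right _ h
  · simp

theorem particleDensity_eq_sum {t N : ℝ} (ht0 : 0 ≤ t) (ht1 : t < 1) (hN : 0 < N) (n : ℕ) (z : ℂ) :
    particleDensity t N n z = 1 / N * ∑ k ∈ Finset.range n,
      ‖(monicHermite t N k).eval z‖ ^ 2 / normSqHermite t N k * Real.exp (-N * potential t z) := by
  cases n with
  | zero => simp [particleDensity]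
  | succ m =>
    unfold particleDensity gibbsDensity
    simp_rw [integral_div, integral_gibbsWeight_insertNth ht0 ht1 hN]
    congr 1
    rw [← Finset.sum_div, Finset.sum_comm, partitionFunction_eq ht0 ht1 hN]
    have hσ : ∀ σ : Perm (Fin (m + 1)), ∑ j : Fin (m + 1),
        ‖(monicHermite t N (σ j)).eval z‖ ^ 2 / normSqHermite t N (σ j) *
          Real.exp (-N * potential t z) * ∏ k : Fin (m + 1), normSqHermite t N k =
        (∑ k ∈ Finset.range (m + 1), ‖(monicHermite t N k).eval z‖ ^ 2 / normSqHermite t N k *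
          Real.exp (-N * potential t z)) * ∏ k : Fin (m + 1), normSqHermite t N k := by
      intro σ
      rw [← Finset.sum_mul, Equiv.sum_comp σ fun k : Fin (m + 1) =>
        ‖(monicHermite t N k).eval z‖ ^ 2 / normSqHermite t N k * Real.exp (-N * potential t z),
        Fin.sum_univ_eq_sum_range fun k =>
        ‖(monicHermite t N k).eval z‖ ^ 2 / normSqHermite t N k * Real.exp (-N * potential t z)]
    rw [Finset.sum_congr rfl fun σ _ => hσ σ, Finset.sum_const, Finset.card_univ,
      Fintype.card_perm, Fintype.card_fin, nsmul_eq_mul]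
    have hp : 0 < ∏ k : Fin (m + 1), normSqHermite t N k :=
      Finset.prod_pos fun k _ => normSqHermite_pos ht0 ht1 hN k
    have hf : (0 : ℝ) < (m + 1).factorial := by positivity
    rw [mul_left_comm, mul_div_cancel_right₀ _ (mul_pos hf hp).ne']

theorem particleDensity_eq {t N : ℝ} (ht0 : 0 ≤ t) (ht1 : t < 1) (hN : 0 < N) (n : ℕ) (z : ℂ) :
    particleDensity t N n z = √(1 - t ^ 2) / Real.pi * Real.exp (-N * potential t z) *
      ∑ k ∈ Finset.range n, mehlerCoeff t ((√(N * (1 - t ^ 2)) : ℝ) * z) k := by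
  rw [particleDensity_eq_sum ht0 ht1 hN]
  simp_rw [norm_sq_monicHermite_div ht0 ht1 hN]
  rw [Finset.mul_sum, Finset.mul_sum]
  refine Finset.sum_congr rfl fun k _ => ?_
  field_simp

/-! ### Chernoff bounds for the density -/

theorem exp_mul_mehlerKernel_eq {t N T s : ℝ} (ht0 : 0 ≤ t) (ht1 : t < 1) (hN : 0 < N)
    (hs : 0 < s) (hts : t * s < 1) {n : ℕ} (hn : (n : ℝ) = N * T) (z : ℂ) :
    Real.exp (-N * potential t z) *
        (mehlerKernel t ((√(N * (1 - t ^ 2)) : ℝ) * z) s / s ^ n) =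
      Real.exp (-N * rate t T s z) / √(1 - t ^ 2 * s ^ 2) := by
  have h2 : 0 < 1 - t ^ 2 := by nlinarith
  have hts0 : 0 ≤ t * s := by positivity
  have hsq := Real.sq_sqrt (show 0 ≤ N * (1 - t ^ 2) by positivity)
  have hZ1 : ‖((√(N * (1 - t ^ 2)) : ℝ) : ℂ) * z‖ ^ 2 = N * (1 - t ^ 2) * ‖z‖ ^ 2 := by
    rw [norm_mul, Complex.norm_real, Real.norm_of_nonneg (Real.sqrt_nonneg _), mul_pow, hsq]
  have hZ2 : ((((√(N * (1 - t ^ 2)) : ℝ) : ℂ) * z) ^ 2).re = N * (1 - t ^ 2) * (z ^ 2).re := by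
    rw [mul_pow, ← Complex.ofReal_pow, hsq, Complex.re_ofReal_mul]
  have hpow : s ^ n = Real.exp (N * T * Real.log s) := by
    rw [← hn, ← Real.log_pow, Real.exp_log (by positivity)]
  unfold mehlerKernel
  rw [hZ1, hZ2, hpow, div_div, mul_comm (√_) (Real.exp _), ← div_div, ← Real.exp_sub,
    mul_div_assoc', ← Real.exp_add]
  congr 2
  have hn1 : ‖z‖ ^ 2 = z.re ^ 2 + z.im ^ 2 := by
    rw [← Complex.normSq_eq_norm_sq, Complex.normSq_apply]; ring
  have hn2 : (z ^ 2).re = z.re ^ 2 - z.im ^ 2 := by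
    rw [sq z, Complex.mul_re]; ring
  have a1 : 1 + t * s ≠ 0 := by positivity
  have a2 : 1 - t * s ≠ 0 := by linarith
  have a3 : 1 - t ^ 2 * s ^ 2 = (1 - t * s) * (1 + t * s) := by ring
  unfold rate
  rw [potential_eq, hn1, hn2, a3]
  field_simp
  ring

theorem particleDensity_nonneg {t N : ℝ} (ht0 : 0 ≤ t) (ht1 : t < 1) (hN : 0 < N) (n : ℕ)
    (z : ℂ) : 0 ≤ particleDensity t N n z := by
  rw [particleDensity_eq ht0 ht1 hN]
  have := Finset.sum_nonneg fun k (_ : k ∈ Finset.range n) =>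
    mehlerCoeff_nonneg t ((√(N * (1 - t ^ 2)) : ℝ) * z) k
  have := Real.pi_pos
  positivity

/-- For `k < n` and `s ≤ 1` one has `s^n ≤ s^k`, so the head is at most `s^(-n)` times the whole
generating function. -/
theorem particleDensity_le {t N T s : ℝ} (ht0 : 0 ≤ t) (ht1 : t < 1) (hN : 0 < N)
    (hs : 0 < s) (hs1 : s ≤ 1) {n : ℕ} (hn : (n : ℝ) = N * T) (z : ℂ) :
    particleDensity t N n z ≤
      √(1 - t ^ 2) / Real.pi / √(1 - t ^ 2 * s ^ 2) * Real.exp (-N * rate t T s z) := by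
  have hts : t * s < 1 := by nlinarith
  have hsum := hasSum_mehlerCoeff ht0 hs.le hts ((√(N * (1 - t ^ 2)) : ℝ) * z)
  have key := exp_mul_mehlerKernel_eq ht0 ht1 hN hs hts hn z
  rw [particleDensity_eq ht0 ht1 hN]
  set Z : ℂ := (√(N * (1 - t ^ 2)) : ℝ) * z
  have h1 : ∑ k ∈ Finset.range n, mehlerCoeff t Z k ≤ mehlerKernel t Z s / s ^ n := by
    rw [le_div_iff₀ (by positivity), Finset.sum_mul]
    refine le_trans (Finset.sum_le_sum fun k hk => ?_) (sum_le_hasSum (Finset.range n)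
      (fun k _ => mul_nonneg (mehlerCoeff_nonneg t Z k) (by positivity)) hsum)
    have := mehlerCoeff_nonneg t Z k
    exact mul_le_mul_of_nonneg_left
      (pow_le_pow_of_le_one hs.le hs1 (Finset.mem_range.1 hk).le) this
  have hpi := Real.pi_pos
  calc √(1 - t ^ 2) / Real.pi * Real.exp (-N * potential t z) *
        ∑ k ∈ Finset.range n, mehlerCoeff t Z k
      ≤ √(1 - t ^ 2) / Real.pi * Real.exp (-N * potential t z) *
        (mehlerKernel t Z s / s ^ n) := by gcongr
    _ = √(1 - t ^ 2) / Real.pi * (Real.exp (-N * rate t T s z) / √(1 - t ^ 2 * s ^ 2)) := by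
      rw [mul_assoc, key]
    _ = _ := by ring

/-- The defect `1/π - ρ_n` is the tail of the Mehler series at 1, and `s^n ≤ s^k` for `k ≥ n`, `s ≥
1`. -/
theorem abs_particleDensity_sub_le {t N T s : ℝ} (ht0 : 0 ≤ t) (ht1 : t < 1) (hN : 0 < N)
    (hs1 : 1 ≤ s) (hts : t * s < 1) {n : ℕ} (hn : (n : ℝ) = N * T) (z : ℂ) :
    |particleDensity t N n z - 1 / Real.pi| ≤
      √(1 - t ^ 2) / Real.pi / √(1 - t ^ 2 * s ^ 2) * Real.exp (-N * rate t T s z) := by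
  have hs : 0 < s := by linarith
  have hsum := hasSum_mehlerCoeff ht0 hs.le hts ((√(N * (1 - t ^ 2)) : ℝ) * z)
  have hsum1 := hasSum_mehlerCoeff ht0 zero_le_one (by linarith) ((√(N * (1 - t ^ 2)) : ℝ) * z)
  have key := exp_mul_mehlerKernel_eq ht0 ht1 hN hs hts hn z
  have key1 := exp_mul_mehlerKernel_eq (T := T) ht0 ht1 hN one_pos (by linarith) hn z
  rw [particleDensity_eq ht0 ht1 hN]
  set Z : ℂ := (√(N * (1 - t ^ 2)) : ℝ) * z
  have hpi := Real.pi_pos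
  have h2 : 0 < 1 - t ^ 2 := by nlinarith
  have hsq := Real.sqrt_pos.2 h2
  -- The rate vanishes at `s = 1`, so the full Mehler series reproduces the bulk density exactly.
  have htot : 1 / Real.pi = √(1 - t ^ 2) / Real.pi * Real.exp (-N * potential t z) *
      mehlerKernel t Z 1 := by
    rw [one_pow, div_one] at key1
    rw [mul_assoc, key1]
    simp only [rate, Real.log_one, sub_self, mul_zero, zero_mul, Real.exp_zero, one_pow, mul_one]
    field_simp
  simp only [one_pow, mul_one] at hsum1
  have ht1' := (hasSum_nat_add_iff' n).2 hsum1
  have hts' := (hasSum_nat_add_iff' n).2 hsum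
  have hlow : ∑ k ∈ Finset.range n, mehlerCoeff t Z k ≤ mehlerKernel t Z 1 :=
    sum_le_hasSum _ (fun k _ => mehlerCoeff_nonneg t Z k) hsum1
  have hhigh : mehlerKernel t Z 1 - ∑ k ∈ Finset.range n, mehlerCoeff t Z k ≤
      mehlerKernel t Z s / s ^ n := by
    have hp : 0 ≤ ∑ k ∈ Finset.range n, mehlerCoeff t Z k * s ^ k :=
      Finset.sum_nonneg fun k _ => mul_nonneg (mehlerCoeff_nonneg t Z k) (by positivity)
    have hle := hasSum_le (fun k => ?_) (ht1'.mul_right (s ^ n)) hts'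
    · rw [le_div_iff₀ (by positivity)]
      linarith
    · have := mehlerCoeff_nonneg t Z (k + n)
      exact mul_le_mul_of_nonneg_left (pow_le_pow_right₀ hs1 (Nat.le_add_left n k)) this
  rw [abs_sub_comm, htot, ← mul_sub, abs_of_nonneg (mul_nonneg (by positivity) (by linarith))]
  calc √(1 - t ^ 2) / Real.pi * Real.exp (-N * potential t z) *
        (mehlerKernel t Z 1 - ∑ k ∈ Finset.range n, mehlerCoeff t Z k)
      ≤ √(1 - t ^ 2) / Real.pi * Real.exp (-N * potential t z) *
        (mehlerKernel t Z s / s ^ n) := by gcongr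
    _ = √(1 - t ^ 2) / Real.pi * (Real.exp (-N * rate t T s z) / √(1 - t ^ 2 * s ^ 2)) := by
      rw [mul_assoc, key]
    _ = _ := by ring

/-! ### From distances to powers of `N`, and conclusion -/

theorem rpow_le_norm_sq_of_notMem_boundaryNhd {t T τ N : ℝ} (hN : 0 < N) {z w : ℂ}
    (hz : z ∉ boundaryNhd t T τ N) (hw : w ∈ frontier (droplet t T)) :
    N ^ (-1 + 2 * τ) ≤ ‖z - w‖ ^ 2 := by
  have h1 : N ^ (-(1 / 2) + τ) ≤ ‖z - w‖ := by
    rw [← dist_eq_norm]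
    exact (not_lt.1 hz).trans (Metric.infDist_le_dist_of_mem hw)
  have h2 : N ^ (-1 + 2 * τ) = (N ^ (-(1 / 2) + τ)) ^ 2 := by
    rw [← Real.rpow_natCast, ← Real.rpow_mul hN.le]
    congr 1; push_cast; ring
  rw [h2]
  gcongr

theorem rpow_two_mul_eq {N τ : ℝ} (hN : 0 < N) : N ^ (2 * τ) = N * N ^ (-1 + 2 * τ) := by
  rw [Real.rpow_add hN, Real.rpow_neg_one]
  field_simp

theorem axisGap_pos {t u : ℝ} (h1 : -1 < t) (h2 : t < 1) (hu : 0 < u) (hu1 : u < 1) :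
    0 < axisGap t u := by
  have a1 : 0 < 1 - t ^ 2 := by nlinarith
  have a2 : 1 - t * u ≠ 0 := by nlinarith
  have a3 : u - 1 ≠ 0 := by linarith
  unfold axisGap
  positivity

theorem exists_forall_rpow_le {τ ε : ℝ} (hε : 0 < ε) :
    ∃ M : ℝ, ∀ N, M < N → τ < 1 / 2 → N ^ (-1 + 2 * τ) ≤ ε := by
  by_cases hτ : τ < 1 / 2
  · have h := (tendsto_rpow_neg_atTop (y := 1 - 2 * τ) (by linarith)).eventually_le_const hε
    obtain ⟨M, hM⟩ := Filter.eventually_atTop.1 h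
    refine ⟨M, fun N hN _ => ?_⟩
    have := hM N hN.le
    rwa [show -(1 - 2 * τ) = -1 + 2 * τ by ring] at this
  · exact ⟨0, fun N _ h => absurd h hτ⟩

end EllipticGinibre

theorem theorem2 (t : ℝ) (ht0 : 0 ≤ t) (ht1 : t < 1) (τ : ℝ) (hτ0 : 0 < τ) (hτ1 : τ ≤ 1 / 2)
    (T : ℝ) (hT : 0 < T) :
    ∃ C₀ > (0 : ℝ), ∃ N₀ > (0 : ℝ), ∀ N : ℝ, N₀ < N → ∀ n : ℕ, (n : ℝ) = N * T →
      (∀ z ∈ interior (EllipticGinibre.droplet t T) \ EllipticGinibre.boundaryNhd t T τ N,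
        |EllipticGinibre.particleDensity t N n z - 1 / Real.pi| <
          C₀ * N ^ (5 / 6 : ℝ) * Real.exp (-N ^ (2 * τ))) ∧
      (τ < 1 / 2 →
        ∀ z ∈ (EllipticGinibre.droplet t T)ᶜ \ EllipticGinibre.boundaryNhd t T τ N,
          |EllipticGinibre.particleDensity t N n z| <
            C₀ * N ^ (5 / 6 : ℝ) * Real.exp (-N ^ (2 * τ))) := by
  open EllipticGinibre in
  have hpi := Real.pi_pos
  have ht2 : 0 < 1 - t ^ 2 := by nlinarith
  have hD : 0 < 1 + 15 * t := by linarith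
  -- The cap `v` solves `1 - t v² = (1-t) v²/16`. With `v ≤ 4` this gives the quarter bound on the
  -- minor semi-axis, while `t v²` stays below 1, even at `t = 0`.
  obtain ⟨v, hv0, hvsq⟩ : ∃ v : ℝ, 0 < v ∧ v ^ 2 * (1 + 15 * t) = 16 := by
    refine ⟨4 / √(1 + 15 * t), by have := Real.sqrt_pos.2 hD; positivity, ?_⟩
    rw [div_pow, Real.sq_sqrt hD.le]
    field_simp
    norm_num
  have hv1 : 1 ≤ v := by nlinarith
  have hv4 : v ≤ 4 := by nlinarith [mul_nonneg ht0 (sq_nonneg v)]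
  have hvt' : 1 - t * v ^ 2 = (1 - t) * v ^ 2 / 16 := by linarith
  have hvt : t * v ^ 2 < 1 := by
    have h : 0 < (1 - t) * v ^ 2 / 16 := by
      have : 0 < 1 - t := by linarith
      positivity
    linarith
  have hv4' : 1 - t * v ^ 2 ≤ v * (1 - t) / 4 := by
    have h : 0 ≤ (1 - t) * v := mul_nonneg (by linarith) hv0.le
    rw [hvt']
    nlinarith
  -- The midpoint of `t` and 1: above `t` for the axis inequality, below 1 so that `ε` is positive.
  set u₀ : ℝ := (1 + t) / 2 with hu₀
  set ε : ℝ := T * min (axisGap t u₀) (axisGap (-t) u₀) with hε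
  have hεpos : 0 < ε := mul_pos hT (lt_min
    (axisGap_pos (by linarith) ht1 (by linarith) (by linarith))
    (axisGap_pos (by linarith) (by linarith) (by linarith) (by linarith)))
  obtain ⟨M, hM⟩ := exists_forall_rpow_le (τ := τ) hεpos
  set D : ℝ := √(1 - t ^ 2) / Real.pi / √(1 - t ^ 2 * (v ^ 2) ^ 2) with hDdef
  have hD0 : 0 ≤ D := by positivity
  -- The prefactor increases with `u`, so its value at the cap serves both regions.
  have hfac : ∀ u : ℝ, 0 ≤ u → u ≤ v →
      √(1 - t ^ 2) / Real.pi / √(1 - t ^ 2 * (u ^ 2) ^ 2) ≤ D := by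
    intro u hu huv
    have hpos : 0 < 1 - t ^ 2 * (v ^ 2) ^ 2 := by
      have : 0 ≤ t * v ^ 2 := by positivity
      nlinarith
    have := Real.sqrt_pos.2 hpos
    rw [hDdef]
    gcongr
  -- The added 1 makes the final inequality strict; `N > 1` absorbs the power `N^(5/6)`, and `N > M`
  -- makes `N^(-1+2τ) ≤ ε` when `τ < 1/2`.
  refine ⟨D + 1, by positivity, max 1 M, by positivity, fun N hN n hn => ?_⟩
  have hN1 : 1 < N := (le_max_left _ _).trans_lt hN
  have hNM : M < N := (le_max_right _ _).trans_lt hN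
  have hN0 : 0 < N := by linarith
  have hfinal : ∀ (x r K : ℝ), x ≤ K * Real.exp (-N * r) → K ≤ D → N ^ (-1 + 2 * τ) ≤ r →
      x < (D + 1) * N ^ (5 / 6 : ℝ) * Real.exp (-N ^ (2 * τ)) := by
    intro x r K hx hK hr
    have h1 : (1 : ℝ) ≤ N ^ (5 / 6 : ℝ) := Real.one_le_rpow hN1.le (by norm_num)
    have h2 : N ^ (2 * τ) ≤ N * r := by
      rw [rpow_two_mul_eq hN0]; gcongr
    calc x ≤ K * Real.exp (-N * r) := hx
      _ ≤ D * Real.exp (-N ^ (2 * τ)) := by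
        gcongr; linarith
      _ < (D + 1) * Real.exp (-N ^ (2 * τ)) := by
        gcongr; linarith
      _ ≤ (D + 1) * N ^ (5 / 6 : ℝ) * Real.exp (-N ^ (2 * τ)) := by
        gcongr
        exact le_mul_of_one_le_right (by linarith) h1
  refine ⟨fun z hz => ?_, fun hτ z hz => ?_⟩
  · obtain ⟨u, hu, w, hw, hle⟩ := exists_rate_ge_of_mem_droplet ht0 ht1 hT hv1 hvt hv4'
      (interior_subset hz.1)
    have hu0 : 0 < u := by linarith [hu.1]
    have hus : t * u ^ 2 < 1 := by
      have : u ^ 2 ≤ v ^ 2 := by have := hu.2; gcongr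
      nlinarith
    exact hfinal _ _ _ (abs_particleDensity_sub_le ht0 ht1 hN0 (one_le_pow₀ hu.1) hus hn z)
      (hfac u hu0.le hu.2) ((rpow_le_norm_sq_of_notMem_boundaryNhd hN0 hz.2 hw).trans hle)
  · obtain ⟨u, hu, h⟩ := exists_rate_ge_of_notMem_droplet (v := u₀) ht0 ht1 hT (by linarith)
      (by linarith) (by linarith) hz.1
    have hu0 : 0 < u := by linarith [hu.1]
    have hr : N ^ (-1 + 2 * τ) ≤ rate t T (u ^ 2) z := by
      rcases h with ⟨w, hw, hle⟩ | h
      · exact (rpow_le_norm_sq_of_notMem_boundaryNhd hN0 hz.2 hw).trans hle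
      · exact (hM N hNM hτ).trans h
    rw [abs_of_nonneg (particleDensity_nonneg ht0 ht1 hN0 n z)]
    exact hfinal _ _ _ (particleDensity_le ht0 ht1 hN0 (by positivity)
      (pow_le_one₀ hu0.le hu.2) hn z) (hfac u hu0.le (hu.2.trans hv1)) hr
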